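/- **Setting.** Fix an integer $K\ge 2$ and constants $A,B,\tau>0$ with $KA\le B<1$ and $\tau\le(1-B)/K$. Let $\mathcal A$ be a measurable space with a probability measure $\mathcal Q$. For every $u\in\mathcal A$ let $S_1(u),\dots,S_K(u)$ be similarities mapping $[0,1]$ into itself, with scaling ratios $a(i,u)$ that are measurable in $u$, such that for all $u$: $A\le\min_i a(i,u)$, $\sum_{i=1}^K a(i,u)\le B$, and $\operatorname{dist}(S_i(u)[0,1],S_j(u)[0,1])\ge\tau$ whenever $i\ne j$. For $\mathbf u=(u_n)_{n\ge1}\in\mathcal A^{\mathbb N}$ let $$F_{\mathbf u}=\bigcap_{n}\bigcup_{i_1,\dots,i_n\in\{1,\dots,K\}} I_{i_1\cdots i_n}(\mathbf u),\qquad I_{i_1\cdots i_n}(\mathbf u)=S_{i_1}(u_1)\circ\cdots\circ S_{i_n}(u_n)[0,1].$$ Let $\mathcal W=\{p\in\mathbb R^K: p_i\ge0,\ \sum_i p_i=1\}$ and $\Lambda=\mathcal A\times\mathcal W$; for $\lambda=(u,v)\in\Lambda$ write $p(i,\lambda)=v_i$. For $\boldsymbol\lambda=(\lambda_n)_{n\ge1}\in\Lambda^{\mathbb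 N}$ with $\lambda_n=(u_n,v_n)$, put $F_{\boldsymbol\lambda}=F_{\mathbf u}$, and let $\mu_{\boldsymbol\lambda}$ be the Borel probability measure with $$\mu_{\boldsymbol\lambda}(I_{i_1\cdots i_n}(\mathbf u))=p(i_1,\lambda_1)\cdots p(i_n,\lambda_n)\quad\text{for all } n \text{ and } i_1,\dots,i_n .$$ An *admissible choice of probabilities* is a probability measure $\mathbb P$ on $\Lambda$ whose marginal on $\mathcal A$ is $\mathcal Q$ and for which there is a $t>0$ with $\mathbb E_{\mathbb P}\big(p(i,\lambda)^{-t}\big)<\infty$ for $i=1,\dots,K$. The sequence $\boldsymbol\lambda$ is then chosen with law $\mathbb P^{\mathbb N}$. A *dimension function* is a map $\Phi:(0,1)\to[0,\infty)$ such that $t^{1+\Phi(t)}$ decreases to $0$ as $t$ decreases to $0$, and such that there are $T,C>0$ with $(2t)^{1+\Phi(2t)}\le C\,t^{1+\Phi(t)}$ for $0<t<T$. It is *large* if, for $t$ near $0$, $\Phi(t)=H(t)\,\log|\log t|/|\log t|$ with $H(t)\to\infty$ as $t\to0$. The *upper $\Phi$-dimension* $\overline{\dim}_\Phi\mu$ of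 $\mu$ is the infimum of all $d$ for which there are $C_1,C_2>0$ such that $$\frac{\mu(B(x,R))}{\mu(B(x,r))}\le C_2\Big(\frac Rr\Big)^d\quad\text{for all }0<r<R^{1+\Phi(R)}\le R\le C_1\text{ and all }x\in\operatorname{supp}\mu .$$ **Theorem.** There is a number $D\in[0,\infty)$ such that $\dim_H F_{\mathbf u}=D$ for $\mathcal Q^{\mathbb N}$-almost every $\mathbf u$, and for every $d\in[D,\infty)$ there is an admissible choice of probabilities $\mathbb P$, under which the weight vector is almost surely a measurable function of $u$, such that for $\mathbb P^{\mathbb N}$-almost every $\boldsymbol\lambda$, $$\overline{\dim}_\Phi\,\mu_{\boldsymbol\lambda}=d\qquad\text{for all large dimension functions }\Phi .$$ -/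

import Mathlib

open MeasureTheory Set Filter Topology
open scoped ENNReal NNReal

/-! ### Large dimension functions and the upper `Φ`-dimension of a measure -/

/-- A dimension function `Φ : (0,1) → [0,∞)`: the map `t ↦ t ^ (1 + Φ t)` decreases to `0` as `t`
decreases to `0`, and it is doubling near zero. Only the values of `Φ` on `(0,1)` are used. -/
structure IsDimensionFunction (Φ : ℝ → ℝ) : Prop where
  nonneg : ∀ t ∈ Ioo (0 : ℝ) 1, 0 ≤ Φ t
  monotoneOn : MonotoneOn (fun t : ℝ => t ^ (1 + Φ t)) (Ioo 0 1)
  tendsto_zero : Tendsto (fun t : ℝ => t ^ (1 + Φ t)) (𝓝[>] 0) (𝓝 0)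
  doubling : ∃ T C : ℝ, 0 < T ∧ T ≤ 1 / 2 ∧ 0 < C ∧
    ∀ t ∈ Ioo 0 T, (2 * t) ^ (1 + Φ (2 * t)) ≤ C * t ^ (1 + Φ t)

/-- A dimension function is large if `Φ t = H t * log |log t| / |log t|` for `t` near `0`, where
`H t → ∞` as `t → 0`. -/
def IsLargeDimensionFunction (Φ : ℝ → ℝ) : Prop :=
  IsDimensionFunction Φ ∧ ∃ H : ℝ → ℝ, Tendsto H (𝓝[>] 0) atTop ∧
    ∀ᶠ t in 𝓝[>] (0 : ℝ), Φ t = H t * (Real.log |Real.log t| / |Real.log t|)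

/-- The upper `Φ`-dimension of a (finite Borel) measure: the infimum in `[-∞, ∞]` (so `+∞` if there
is no such `d`) of the exponents `d` for which
`μ (B(x,R)) / μ (B(x,r)) ≤ C₂ (R/r)^d` for all `x ∈ supp μ` and `0 < r < R^(1+Φ(R)) ≤ R ≤ C₁`. -/
noncomputable def upperPhiDim {X : Type*} [PseudoMetricSpace X] [MeasurableSpace X]
    (Φ : ℝ → ℝ) (μ : Measure X) : EReal :=
  sInf ((fun d : ℝ => (d : EReal)) '' {d : ℝ | ∃ C₁ C₂ : ℝ, 0 < C₁ ∧ C₁ < 1 ∧ 0 < C₂ ∧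
    ∀ r R : ℝ, 0 < r → r < R ^ (1 + Φ R) → R ^ (1 + Φ R) ≤ R → 0 < R → R ≤ C₁ →
      ∀ x ∈ μ.support,
        μ.real (Metric.ball x R) / μ.real (Metric.ball x r) ≤ C₂ * (R / r) ^ d})

/-! ### The random iterated function systems -/

/-- A family, indexed by `u ∈ 𝒜`, of uniformly strongly separated iterated function systems
`{S 1 u, …, S K u}` of similarities acting on `[0,1]`, with scaling ratios `a i u`. -/
structure IFSFamily (K : ℕ) (𝒜 : Type*) [MeasurableSpace 𝒜] where
  S : Fin K → 𝒜 → ℝ → ℝ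
  a : Fin K → 𝒜 → ℝ
  A : ℝ
  B : ℝ
  τ : ℝ
  A_pos : 0 < A
  τ_pos : 0 < τ
  K_mul_A_le : K * A ≤ B
  B_lt_one : B < 1
  τ_le : τ ≤ (1 - B) / K
  measurable_a : ∀ i, Measurable (a i)
  mapsTo : ∀ i u, MapsTo (S i u) (Icc 0 1) (Icc 0 1)
  similarity : ∀ i u, ∀ x ∈ Icc (0 : ℝ) 1, ∀ y ∈ Icc (0 : ℝ) 1,
    dist (S i u x) (S i u y) = a i u * dist x y
  A_le : ∀ i u, A ≤ a i u
  sum_le : ∀ u, ∑ i, a i u ≤ B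
  separated : ∀ u, ∀ i j, i ≠ j → ∀ x ∈ Icc (0 : ℝ) 1, ∀ y ∈ Icc (0 : ℝ) 1,
    τ ≤ dist (S i u x) (S j u y)

/-- The space `𝒲` of all probability weight vectors. -/
abbrev Weights (K : ℕ) : Type := stdSimplex ℝ (Fin K)

/-- The probability measure on `{1, …, K}` with weights `w`. -/
noncomputable def weightMeasure {K : ℕ} (w : Weights K) : Measure (Fin K) :=
  ∑ i, ENNReal.ofReal (w i) • Measure.dirac i

instance weightMeasure.isProbabilityMeasure {K : ℕ} (w : Weights K) :
    IsProbabilityMeasure (weightMeasure w) := by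
  refine ⟨?_⟩
  simp only [weightMeasure, Measure.coe_finsetSum, Finset.sum_apply, Measure.smul_apply,
    measure_univ, smul_eq_mul, mul_one]
  refine (ENNReal.ofReal_sum_of_nonneg (fun i _ => w.2.1 i)).symm.trans ?_
  exact (congrArg ENNReal.ofReal w.2.2).trans ENNReal.ofReal_one

namespace IFSFamily

variable {K : ℕ} {𝒜 : Type*} [MeasurableSpace 𝒜] (F : IFSFamily K 𝒜)

/-- `wordMap u i n` is `S (i 0) (u 0) ∘ ⋯ ∘ S (i (n-1)) (u (n-1))`. -/
def wordMap (u : ℕ → 𝒜) (i : ℕ → Fin K) : ℕ → ℝ → ℝ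
  | 0 => id
  | n + 1 => wordMap u i n ∘ F.S (i n) (u n)

/-- The step `n` Moran interval of the word formed by the first `n` letters of `i`. -/
def moranInterval (u : ℕ → 𝒜) (i : ℕ → Fin K) (n : ℕ) : Set ℝ :=
  F.wordMap u i n '' Icc 0 1

/-- The Moran set: at step `n`, the union is over all words of length `n` (every one of which is the
beginning of some sequence `i`). -/
def moranSet (u : ℕ → 𝒜) : Set ℝ :=
  ⋂ n : ℕ, ⋃ i : ℕ → Fin K, F.moranInterval u i n

/-- The point of the Moran set that is coded by the sequence `i`: the unique common point of the
nested Moran intervals `moranInterval u i n`. -/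
noncomputable def codingMap (u : ℕ → 𝒜) (i : ℕ → Fin K) : ℝ :=
  limUnder atTop fun n => F.wordMap u i n 0

/-- The Moran measure of a sequence `ω n = (u n, w n)` of pairs of an IFS and a weight vector: the law
of the coded point when the letters are drawn independently, the `n`-th one with weights `w n`.
By `moranMeasure_moranInterval` below, it gives each Moran interval the product of the weights of
its letters. -/
noncomputable def moranMeasure (ω : ℕ → 𝒜 × Weights K) : Measure ℝ :=
  (Measure.infinitePi fun n => weightMeasure (ω n).2).map (F.codingMap fun n => (ω n).1)

/-! Helper facts: the Moran measure obeys the defining rule for the mass of Moran intervals. -/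

theorem a_pos (i : Fin K) (u : 𝒜) : 0 < F.a i u := F.A_pos.trans_le (F.A_le i u)

theorem a_le_B (i : Fin K) (u : 𝒜) : F.a i u ≤ F.B :=
  (Finset.single_le_sum (f := fun j => F.a j u) (fun j _ => (F.a_pos j u).le)
    (Finset.mem_univ i)).trans (F.sum_le u)

theorem wordMap_mapsTo (u : ℕ → 𝒜) (i : ℕ → Fin K) (n : ℕ) :
    MapsTo (F.wordMap u i n) (Icc 0 1) (Icc 0 1) := by
  induction n with
  | zero => exact mapsTo_id _
  | succ n ih => exact ih.comp (F.mapsTo _ _)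

theorem dist_wordMap (u : ℕ → 𝒜) (i : ℕ → Fin K) (n : ℕ) {x y : ℝ} (hx : x ∈ Icc (0 : ℝ) 1)
    (hy : y ∈ Icc (0 : ℝ) 1) : dist (F.wordMap u i n x) (F.wordMap u i n y) =
      (∏ k ∈ Finset.range n, F.a (i k) (u k)) * dist x y := by
  induction n generalizing x y with
  | zero => simp [wordMap]
  | succ n ih =>
    simp only [wordMap, Function.comp_apply]
    rw [ih (F.mapsTo _ _ hx) (F.mapsTo _ _ hy), F.similarity _ _ x hx y hy,
      Finset.prod_range_succ, mul_assoc]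

theorem isClosed_moranInterval (u : ℕ → 𝒜) (i : ℕ → Fin K) (n : ℕ) :
    IsClosed (F.moranInterval u i n) := by
  refine (isCompact_Icc.image_of_continuousOn ?_).isClosed
  have hp : 0 ≤ ∏ k ∈ Finset.range n, F.a (i k) (u k) :=
    Finset.prod_nonneg fun k _ => (F.a_pos _ _).le
  exact (LipschitzOnWith.of_dist_le_mul (K := ⟨_, hp⟩) fun x hx y hy =>
    (F.dist_wordMap u i n hx hy).le).continuousOn

theorem moranInterval_antitone (u : ℕ → 𝒜) (i : ℕ → Fin K) : Antitone (F.moranInterval u i) := by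
  refine antitone_nat_of_succ_le fun n => ?_
  rintro _ ⟨x, hx, rfl⟩
  exact ⟨_, F.mapsTo _ _ hx, rfl⟩

theorem tendsto_codingMap (u : ℕ → 𝒜) (i : ℕ → Fin K) :
    Tendsto (fun n => F.wordMap u i n 0) atTop (𝓝 (F.codingMap u i)) := by
  refine CauchySeq.tendsto_limUnder ?_
  have h0 : (0 : ℝ) ∈ Icc (0 : ℝ) 1 := by simp
  refine cauchySeq_of_le_geometric F.B 1 F.B_lt_one fun n => ?_
  have hm := F.mapsTo (i n) (u n) h0
  simp only [wordMap, Function.comp_apply]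
  rw [F.dist_wordMap u i n h0 hm, one_mul]
  have h1 : ∏ k ∈ Finset.range n, F.a (i k) (u k) ≤ F.B ^ n := by
    refine (Finset.prod_le_prod (fun k _ => (F.a_pos _ _).le) fun k _ => F.a_le_B _ _).trans ?_
    simp
  have h2 : dist (0 : ℝ) (F.S (i n) (u n) 0) ≤ 1 := by
    rw [Real.dist_eq, abs_le]; constructor <;> linarith [hm.1, hm.2]
  exact (mul_le_of_le_one_right (Finset.prod_nonneg fun k _ => (F.a_pos _ _).le) h2).trans h1

theorem codingMap_mem (u : ℕ → 𝒜) (i : ℕ → Fin K) (n : ℕ) :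
    F.codingMap u i ∈ F.moranInterval u i n :=
  (F.isClosed_moranInterval u i n).mem_of_tendsto (F.tendsto_codingMap u i) <|
    (eventually_ge_atTop n).mono fun _ hm =>
      F.moranInterval_antitone u i hm ⟨0, by simp, rfl⟩

theorem wordMap_congr (u : ℕ → 𝒜) {i j : ℕ → Fin K} {n : ℕ} (h : ∀ k < n, i k = j k) :
    F.wordMap u i n = F.wordMap u j n := by
  induction n with
  | zero => rfl
  | succ n ih =>
    simp only [wordMap]
    rw [ih fun k hk => h k (hk.trans n.lt_succ_self), h n n.lt_succ_self]

theorem eq_of_wordMap_eq (u : ℕ → 𝒜) {i j : ℕ → Fin K} {n : ℕ} {x y : ℝ} (hx : x ∈ Icc (0 : ℝ) 1)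
    (hy : y ∈ Icc (0 : ℝ) 1) (h : F.wordMap u i n x = F.wordMap u j n y) :
    ∀ k < n, i k = j k := by
  induction n generalizing x y with
  | zero => simp
  | succ n ih =>
    have h' := ih (F.mapsTo (i n) (u n) hx) (F.mapsTo (j n) (u n) hy) h
    intro k hk
    rcases Nat.lt_succ_iff_lt_or_eq.1 hk with hk | rfl
    · exact h' k hk
    · by_contra hne
      have hs := F.separated (u k) _ _ hne x hx y hy
      have hd := F.dist_wordMap u j k (F.mapsTo (i k) (u k) hx) (F.mapsTo (j k) (u k) hy)
      simp only [wordMap, Function.comp_apply] at h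
      rw [← h, F.wordMap_congr u h', dist_self] at hd
      have := Finset.prod_pos (s := Finset.range k) fun l _ => F.a_pos (j l) (u l)
      have := mul_pos this (F.τ_pos.trans_le hs)
      linarith

theorem measurable_codingMap (u : ℕ → 𝒜) : Measurable (F.codingMap u) := by
  have key : ∀ n x, Measurable fun i : ℕ → Fin K => F.wordMap u i n x := by
    intro n
    induction n with
    | zero => exact fun x => measurable_const
    | succ n ih =>
      intro x
      have h : Measurable fun q : Fin K × (ℕ → Fin K) => F.wordMap u q.2 n (F.S q.1 (u n) x) :=
        measurable_from_prod_countable_right fun c => ih (F.S c (u n) x)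
      have h' : Measurable fun i : ℕ → Fin K => (i n, i) :=
        (measurable_pi_apply n).prodMk measurable_id
      exact h.comp h'
  exact measurable_of_tendsto_metrizable (fun n => key n 0)
    (tendsto_pi_nhds.2 fun i => F.tendsto_codingMap u i)

instance (ω : ℕ → 𝒜 × Weights K) : IsProbabilityMeasure (F.moranMeasure ω) :=
  Measure.isProbabilityMeasure_map (F.measurable_codingMap _).aemeasurable

theorem moranMeasure_moranInterval (ω : ℕ → 𝒜 × Weights K) (i : ℕ → Fin K) (n : ℕ) :
    F.moranMeasure ω (F.moranInterval (fun k => (ω k).1) i n) =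
      ∏ k ∈ Finset.range n, ENNReal.ofReal ((ω k).2 (i k)) := by
  rw [moranMeasure, Measure.map_apply (F.measurable_codingMap _)
    (F.isClosed_moranInterval _ _ _).measurableSet]
  have hset : F.codingMap (fun k => (ω k).1) ⁻¹' F.moranInterval (fun k => (ω k).1) i n =
      Set.pi (Finset.range n) fun k => {i k} := by
    ext j
    simp only [mem_preimage, Set.mem_pi, Finset.coe_range, Set.mem_Iio, mem_singleton_iff]
    constructor
    · rintro ⟨x, hx, hxj⟩
      obtain ⟨y, hy, hyj⟩ := F.codingMap_mem (fun k => (ω k).1) j n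
      exact F.eq_of_wordMap_eq _ hy hx (hyj.trans hxj.symm)
    · intro h
      have := F.codingMap_mem (fun k => (ω k).1) j n
      rwa [moranInterval, F.wordMap_congr _ h] at this
  rw [hset, Measure.infinitePi_pi _ fun k _ => measurableSet_singleton _]
  refine Finset.prod_congr rfl fun k _ => ?_
  simp [weightMeasure, Measure.finsetSum_apply, Set.indicator_apply]

end IFSFamily

/-- The admissible laws `P` on `Λ = 𝒜 × 𝒲`: the marginal of `P` on `𝒜` is the given law `Q` of the
IFSs, and for some `t > 0` the expectation of `p(i,·) ^ (-t)` is finite for each `i`. -/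
structure IsAdmissibleLaw {K : ℕ} {𝒜 : Type*} [MeasurableSpace 𝒜] (Q : Measure 𝒜)
    (P : ProbabilityMeasure (𝒜 × Weights K)) : Prop where
  marginal : (P : Measure (𝒜 × Weights K)).map Prod.fst = Q
  moment : ∃ t : ℝ, 0 < t ∧ ∀ i : Fin K,
    ∫⁻ x, ENNReal.ofReal (x.2 i) ^ (-t) ∂(P : Measure (𝒜 × Weights K)) < ∞

/-!
For a sequence `u` of systems put `X n = log (∑ j, a j (u n) ^ d) - log θ`. If the weights of step
`n` satisfy `w i ≥ a i ^ d * exp (-X n)`, with equality for at least one letter `i`, then the mass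
of a Moran interval of step `n + l` relative to its ancestor of step `n` is at least the `d`-th
power of the relative length times `exp (-∑ k < l, X (n + k))`, and equality occurs along one code.
Let `θ` be such that `X` has expectation zero. Since `X` is bounded and the steps are independent,
Hoeffding's inequality and the Borel–Cantelli lemma give, almost surely and for each `ε > 0`, that
these block sums are at most `ε l + C` in modulus for all blocks with `l ≥ M log (n + 1)`
(`ae_hasSublinearBlockSums`). For a large dimension function the scales `R` and
`r < R ^ (1 + Φ R)` are always separated by that many steps (`eventually_mul_log_le`), and by the
strong separation a ball has the mass of a Moran interval of comparable length
(`measureReal_ball_le`, `le_measureReal_ball`). Hence the upper `Φ`-dimension is `d`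
(`upperPhiDim_moranMeasure_le`, `le_upperPhiDim_moranMeasure`).

The expectation of `X` vanishes for `θ = exp (meanPressure d)`, where
`meanPressure s = E log (∑ j, a j ^ s)` is strictly decreasing with a zero `D`. For `d ≥ D` one has
`θ ≤ 1`, so the mixture of `θ` times the weights proportional to `a ^ d` and `1 - θ` times a point
mass at one letter (`tiltedWeights`) is a weight vector, and it has the required property, with
equality for all the other letters, which exist because `K ≥ 2`. These weights are bounded below, so
all the moments are finite.

For `d = D` one has `θ = 1`, and the same block sums with `n = 0` show that `D` is the Hausdorff
dimension: from above by covering with the Moran intervals of one step (`dimH_moranSet_le`), from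
below by the mass distribution principle (`le_dimH_moranSet`).
-/

/-! ### Block sums of bounded independent variables -/

/-- The sums of `X` over blocks `n, …, n + l - 1` are `o(l)`, up to an additive constant, as soon as
the length `l` of the block is at least a large multiple of `log (n + 1)`. -/
def HasSublinearBlockSums (X : ℕ → ℝ) : Prop :=
  ∀ ε : ℝ, 0 < ε → ∃ M C : ℝ, ∀ n l : ℕ, M * Real.log (n + 1) ≤ l →
    |∑ k ∈ Finset.range l, X (n + k)| ≤ ε * l + C

theorem ae_sum_block_le {E : Type*} [MeasurableSpace E] (μ : Measure E) [IsProbabilityMeasure μ]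
    {g : E → ℝ} (hg : Measurable g) {b : ℝ} (hb : 0 < b) (hgb : ∀ x, |g x| ≤ b)
    (h0 : ∫ x, g x ∂μ = 0) {ε : ℝ} (hε : 0 < ε) :
    ∃ M : ℝ, ∀ᵐ ω ∂(Measure.infinitePi fun _ : ℕ => μ), ∃ C : ℝ, ∀ n l : ℕ,
      M * Real.log (n + 1) ≤ l → ∑ k ∈ Finset.range l, g (ω (n + k)) ≤ ε * l + C := by
  set ν := Measure.infinitePi fun _ : ℕ => μ
  set c : ℝ≥0 := (‖b - -b‖₊ / 2) ^ 2 with hc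
  have hcpos : (0 : ℝ) < c := by
    have : (c : ℝ) = b ^ 2 := by
      simp only [hc, NNReal.coe_pow, NNReal.coe_div, coe_nnnorm, Real.norm_eq_abs]
      rw [show b - -b = 2 * b by ring, abs_of_pos (by linarith)]
      simp
    rw [this]; positivity
  set δ : ℝ := ε ^ 2 / (2 * c) with hδ
  have hδpos : 0 < δ := by positivity
  have hind : ProbabilityTheory.iIndepFun (fun (k : ℕ) (ω : ℕ → E) => g (ω k)) ν :=
    ProbabilityTheory.iIndepFun_infinitePi fun _ => hg
  have hsub : ∀ k : ℕ, ProbabilityTheory.HasSubgaussianMGF (fun ω : ℕ → E => g (ω k)) c ν := by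
    intro k
    refine ProbabilityTheory.hasSubgaussianMGF_of_mem_Icc_of_integral_eq_zero
      (hg.comp (measurable_pi_apply k)).aemeasurable
      (ae_of_all _ fun ω => abs_le.1 (hgb (ω k))) ?_
    rw [← h0, ← (measurePreserving_eval_infinitePi (fun _ : ℕ => μ) k).map_eq,
      integral_map (measurable_pi_apply k).aemeasurable hg.aestronglyMeasurable]
  have hhoeff : ∀ n l : ℕ, ν {ω | ε * l ≤ ∑ k ∈ Finset.range l, g (ω (n + k))} ≤
      ENNReal.ofReal (Real.exp (-(δ * l))) := by
    intro n l
    have hind' := hind.precomp (g := fun k : ℕ => n + k) (add_right_injective n)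
    have h := ProbabilityTheory.HasSubgaussianMGF.measure_sum_range_ge_le_of_iIndepFun
      (n := l) hind' (fun k _ => hsub (n + k)) (ε := ε * l) (by positivity)
    have he : -(ε * l) ^ 2 / (2 * l * c) = -(δ * l) := by
      rcases Nat.eq_zero_or_pos l with rfl | hl
      · simp
      · have : (0 : ℝ) < l := by exact_mod_cast hl
        rw [hδ]; field_simp
    rw [he] at h
    rw [← ENNReal.ofReal_toReal (measure_ne_top ν _)]
    exact ENNReal.ofReal_le_ofReal h
  set M : ℝ := 4 / δ with hM
  refine ⟨M, ?_⟩
  let s : ℕ × ℕ → Set (ℕ → E) := fun q =>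
    {ω | M * Real.log (q.1 + 1) ≤ q.2 ∧ ε * q.2 ≤ ∑ k ∈ Finset.range q.2, g (ω (q.1 + k))}
  have hs : ∀ q, ν (s q) ≤
      ENNReal.ofReal (1 / ((q.1 : ℝ) + 1) ^ 2 * Real.exp (-(δ / 2)) ^ q.2) := by
    rintro ⟨n, l⟩
    by_cases hl : M * Real.log (n + 1) ≤ l
    · refine (measure_mono fun ω hω => hω.2).trans ((hhoeff n l).trans ?_)
      refine ENNReal.ofReal_le_ofReal ?_
      have hn : (0 : ℝ) < n + 1 := by positivity
      -- half of the exponential decay pays for the summation over the starting points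
      have h1 : (1 : ℝ) / ((n : ℝ) + 1) ^ 2 = Real.exp (-(2 * Real.log (n + 1))) := by
        rw [Real.exp_neg, two_mul, Real.exp_add, Real.exp_log hn, one_div, sq]
      rw [h1, ← Real.exp_nat_mul, ← Real.exp_add]
      refine Real.exp_le_exp.2 ?_
      have h2 : 4 * Real.log (n + 1) ≤ δ * l := by
        have := mul_le_mul_of_nonneg_left hl hδpos.le
        rwa [hM, ← mul_assoc, mul_div_cancel₀ _ hδpos.ne'] at this
      linarith
    · have : s (n, l) = ∅ := by
        ext ω
        simp only [s, mem_ofPred_eq, mem_empty_iff_false, iff_false]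
        exact fun h => hl h.1
      simp [this]
  have hsum : Summable fun q : ℕ × ℕ =>
      1 / ((q.1 : ℝ) + 1) ^ 2 * Real.exp (-(δ / 2)) ^ q.2 := by
    refine Summable.mul_of_nonneg (f := fun n : ℕ => 1 / ((n : ℝ) + 1) ^ 2)
      (g := fun l : ℕ => Real.exp (-(δ / 2)) ^ l) ?_ ?_ (fun n => by positivity)
      (fun l => by positivity)
    · have h := (summable_nat_add_iff 1).2 (Real.summable_one_div_nat_pow.2 one_lt_two)
      simpa using h
    · exact summable_geometric_of_lt_one (Real.exp_pos _).le
        (Real.exp_lt_one_iff.2 (by linarith))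
  have hfin : ∑' q, ν (s q) ≠ ∞ := by
    refine ((ENNReal.tsum_le_tsum hs).trans_lt ?_).ne
    rw [← ENNReal.ofReal_tsum_of_nonneg (fun q => by positivity) hsum]
    exact ENNReal.ofReal_lt_top
  filter_upwards [ae_finite_setOfPred_mem hfin] with ω hω
  obtain ⟨C, hC⟩ := (hω.image fun q : ℕ × ℕ =>
    ∑ k ∈ Finset.range q.2, g (ω (q.1 + k))).bddAbove
  refine ⟨max C 0, fun n l hl => ?_⟩
  have hεl : 0 ≤ ε * l := by positivity
  rcases le_total (ε * l) (∑ k ∈ Finset.range l, g (ω (n + k))) with h | h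
  · have := hC (mem_image_of_mem _ (show (n, l) ∈ {q | ω ∈ s q} from ⟨hl, h⟩))
    exact this.trans ((le_max_left C 0).trans (le_add_of_nonneg_left hεl))
  · exact h.trans (le_add_of_nonneg_right (le_max_right _ _))

/-- Hoeffding's inequality bounds the probability that the sum over a block of length `l` exceeds
`ε l` by `exp (-δ l)`, which is summable over all blocks with `l ≥ (4 / δ) log (n + 1)`; so by
Borel–Cantelli only finitely many of these blocks are exceptional. -/
theorem ae_hasSublinearBlockSums {E : Type*} [MeasurableSpace E] (μ : Measure E)
    [IsProbabilityMeasure μ] {g : E → ℝ} (hg : Measurable g) {b : ℝ} (hgb : ∀ x, |g x| ≤ b)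
    (h0 : ∫ x, g x ∂μ = 0) :
    ∀ᵐ ω ∂(Measure.infinitePi fun _ : ℕ => μ), HasSublinearBlockSums fun n => g (ω n) := by
  have hb' : ∀ x, |g x| ≤ |b| + 1 := fun x => by linarith [hgb x, le_abs_self b]
  have hbp : 0 < |b| + 1 := by positivity
  have hε : ∀ N : ℕ, (0 : ℝ) < 1 / (N + 1) := fun N => by positivity
  choose M₁ h₁ using fun N : ℕ => ae_sum_block_le μ hg hbp hb' h0 (hε N)
  choose M₂ h₂ using fun N : ℕ => ae_sum_block_le μ hg.neg hbp
    (fun x => by simpa using hb' x) (by simp [integral_neg, h0]) (hε N)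
  filter_upwards [ae_all_iff.2 h₁, ae_all_iff.2 h₂] with ω hω₁ hω₂ ε hεpos
  obtain ⟨N, hN⟩ := exists_nat_one_div_lt hεpos
  obtain ⟨C₁, hC₁⟩ := hω₁ N
  obtain ⟨C₂, hC₂⟩ := hω₂ N
  refine ⟨max (M₁ N) (M₂ N), max C₁ C₂, fun n l hl => ?_⟩
  have hlog : 0 ≤ Real.log ((n : ℝ) + 1) :=
    Real.log_nonneg (le_add_of_nonneg_left n.cast_nonneg)
  have hp := hC₁ n l ((mul_le_mul_of_nonneg_right (le_max_left _ _) hlog).trans hl)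
  have hm := hC₂ n l ((mul_le_mul_of_nonneg_right (le_max_right _ _) hlog).trans hl)
  simp only [Pi.neg_apply, Finset.sum_neg_distrib] at hm
  have hle : 1 / ((N : ℝ) + 1) * l ≤ ε * l := mul_le_mul_of_nonneg_right hN.le l.cast_nonneg
  rw [abs_le]
  constructor
  · linarith [le_max_right C₁ C₂]
  · linarith [le_max_left C₁ C₂]

namespace IFSFamily

variable {K : ℕ} {𝒜 : Type*} [MeasurableSpace 𝒜] (F : IFSFamily K 𝒜)

/-! ### Moran intervals and balls -/

/-- The length of the Moran interval `moranInterval u i n`: the product of the first `n` scaling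
ratios along the word `i`. -/
def cylinderLength (u : ℕ → 𝒜) (i : ℕ → Fin K) (n : ℕ) : ℝ :=
  ∏ k ∈ Finset.range n, F.a (i k) (u k)

theorem cylinderLength_zero (u : ℕ → 𝒜) (i : ℕ → Fin K) : F.cylinderLength u i 0 = 1 := by
  simp [cylinderLength]

theorem cylinderLength_succ (u : ℕ → 𝒜) (i : ℕ → Fin K) (n : ℕ) :
    F.cylinderLength u i (n + 1) = F.cylinderLength u i n * F.a (i n) (u n) :=
  Finset.prod_range_succ _ _

theorem cylinderLength_add (u : ℕ → 𝒜) (i : ℕ → Fin K) (n l : ℕ) :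
    F.cylinderLength u i (n + l) =
      F.cylinderLength u i n * ∏ k ∈ Finset.range l, F.a (i (n + k)) (u (n + k)) :=
  Finset.prod_range_add _ _ _

theorem cylinderLength_pos (u : ℕ → 𝒜) (i : ℕ → Fin K) (n : ℕ) : 0 < F.cylinderLength u i n :=
  Finset.prod_pos fun _ _ => F.a_pos _ _

theorem A_le_B (i : Fin K) (u : 𝒜) : F.A ≤ F.B := (F.A_le i u).trans (F.a_le_B i u)

theorem cylinderLength_add_le (u : ℕ → 𝒜) (i : ℕ → Fin K) (n l : ℕ) :
    F.cylinderLength u i (n + l) ≤ F.cylinderLength u i n * F.B ^ l := by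
  rw [cylinderLength_add]
  refine mul_le_mul_of_nonneg_left ?_ (F.cylinderLength_pos u i n).le
  exact (Finset.prod_le_prod (fun k _ => (F.a_pos _ _).le) fun k _ => F.a_le_B _ _).trans (by simp)

theorem le_cylinderLength_add (u : ℕ → 𝒜) (i : ℕ → Fin K) (n l : ℕ) :
    F.cylinderLength u i n * F.A ^ l ≤ F.cylinderLength u i (n + l) := by
  rw [cylinderLength_add]
  refine mul_le_mul_of_nonneg_left ?_ (F.cylinderLength_pos u i n).le
  refine le_trans (by simp) (Finset.prod_le_prod (fun k _ => F.A_pos.le)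
    fun k _ => F.A_le (i (n + k)) (u (n + k)))

theorem cylinderLength_le_pow (u : ℕ → 𝒜) (i : ℕ → Fin K) (n : ℕ) :
    F.cylinderLength u i n ≤ F.B ^ n := by
  simpa [cylinderLength_zero] using F.cylinderLength_add_le u i 0 n

theorem cylinderLength_antitone (u : ℕ → 𝒜) (i : ℕ → Fin K) : Antitone (F.cylinderLength u i) := by
  refine antitone_nat_of_succ_le fun n => ?_
  rw [cylinderLength_succ]
  exact mul_le_of_le_one_right (F.cylinderLength_pos u i n).le
    ((F.a_le_B _ _).trans F.B_lt_one.le)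

theorem tendsto_cylinderLength (u : ℕ → 𝒜) (i : ℕ → Fin K) :
    Tendsto (F.cylinderLength u i) atTop (𝓝 0) :=
  squeeze_zero (fun n => (F.cylinderLength_pos u i n).le) (F.cylinderLength_le_pow u i)
    (tendsto_pow_atTop_nhds_zero_of_lt_one
      (F.A_pos.le.trans (F.A_le_B (i 0) (u 0))) F.B_lt_one)

/-- Every scale `ρ ∈ (0, 1]` lies between the lengths of two consecutive Moran intervals. -/
theorem exists_cylinderLength_lt_le (u : ℕ → 𝒜) (i : ℕ → Fin K) {ρ : ℝ} (h0 : 0 < ρ) (h1 : ρ ≤ 1) :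
    ∃ n, F.cylinderLength u i (n + 1) < ρ ∧ ρ ≤ F.cylinderLength u i n := by
  classical
  have hex : ∃ n, F.cylinderLength u i n < ρ :=
    ((F.tendsto_cylinderLength u i).eventually (gt_mem_nhds h0)).exists
  obtain ⟨n, hn⟩ : ∃ n, Nat.find hex = n + 1 := by
    refine Nat.exists_eq_succ_of_ne_zero fun h => ?_
    have := Nat.find_spec hex
    rw [h, cylinderLength_zero] at this
    exact this.not_ge h1
  refine ⟨n, hn ▸ Nat.find_spec hex, not_lt.1 (Nat.find_min hex ?_)⟩
  omega

theorem dist_codingMap_le (u : ℕ → 𝒜) {i j : ℕ → Fin K} {n : ℕ} (h : ∀ k < n, i k = j k) :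
    dist (F.codingMap u i) (F.codingMap u j) ≤ F.cylinderLength u i n := by
  obtain ⟨x, hx, hxi⟩ := F.codingMap_mem u i n
  obtain ⟨y, hy, hyj⟩ := F.codingMap_mem u j n
  rw [← hxi, ← hyj, ← F.wordMap_congr u h, F.dist_wordMap u i n hx hy]
  exact mul_le_of_le_one_right (F.cylinderLength_pos u i n).le (Real.dist_le_of_mem_Icc_01 hx hy)

theorem dist_le_of_mem_moranInterval (u : ℕ → 𝒜) (i : ℕ → Fin K) (n : ℕ) {x y : ℝ}
    (hx : x ∈ F.moranInterval u i n) (hy : y ∈ F.moranInterval u i n) :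
    dist x y ≤ F.cylinderLength u i n := by
  obtain ⟨x, hx, rfl⟩ := hx
  obtain ⟨y, hy, rfl⟩ := hy
  rw [F.dist_wordMap u i n hx hy]
  exact mul_le_of_le_one_right (F.cylinderLength_pos u i n).le (Real.dist_le_of_mem_Icc_01 hx hy)

/-- At the first letter `q` where the codes differ, the two points lie in different images of
`[0, 1]` inside a Moran interval of step `q`, hence at distance at least `τ` times its length. -/
theorem eq_of_dist_codingMap_lt (u : ℕ → 𝒜) {i j : ℕ → Fin K} {n : ℕ}
    (h : dist (F.codingMap u i) (F.codingMap u j) < F.τ * F.cylinderLength u i n) :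
    ∀ k < n, i k = j k := by
  classical
  by_contra! hex
  have hq := Nat.find_spec hex
  set q := Nat.find hex
  have hmin : ∀ k < q, i k = j k := fun k hk => by
    by_contra hne
    exact Nat.find_min hex hk ⟨hk.trans hq.1, hne⟩
  obtain ⟨x, hx, hxi⟩ := F.codingMap_mem u i (q + 1)
  obtain ⟨y, hy, hyj⟩ := F.codingMap_mem u j (q + 1)
  simp only [wordMap, Function.comp_apply] at hxi hyj
  rw [← hxi, ← hyj, ← F.wordMap_congr u hmin,
    F.dist_wordMap u i q (F.mapsTo _ _ hx) (F.mapsTo _ _ hy)] at h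
  have h1 := F.separated (u q) _ _ hq.2 x hx y hy
  have h2 : F.τ * F.cylinderLength u i n ≤ F.τ * F.cylinderLength u i q :=
    mul_le_mul_of_nonneg_left (F.cylinderLength_antitone u i hq.1.le) F.τ_pos.le
  have h3 := mul_le_mul_of_nonneg_left h1 (F.cylinderLength_pos u i q).le
  simp only [cylinderLength] at h h2 h3
  linarith

theorem continuous_codingMap (u : ℕ → 𝒜) : Continuous (F.codingMap u) := by
  refine continuous_iff_continuousAt.2 fun i => Metric.tendsto_nhds.2 fun ε hε => ?_
  obtain ⟨n, hn⟩ := ((F.tendsto_cylinderLength u i).eventually (gt_mem_nhds hε)).exists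
  have : ∀ᶠ j in 𝓝 i, ∀ k ∈ Finset.range n, i k = j k := by
    refine (Filter.eventually_all_finset _).2 fun k _ => ?_
    have := (continuous_apply k).continuousAt (x := i) |>.eventually
      ((isOpen_discrete {i k}).mem_nhds (mem_singleton (i k)))
    filter_upwards [this] with j hj using (mem_singleton_iff.1 hj).symm
  filter_upwards [this] with j hj
  rw [dist_comm]
  exact (F.dist_codingMap_le u fun k hk => hj k (Finset.mem_range.2 hk)).trans_lt hn

theorem isClosed_range_codingMap (u : ℕ → 𝒜) : IsClosed (range (F.codingMap u)) :=
  (isCompact_range (F.continuous_codingMap u)).isClosed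

theorem range_codingMap_subset_moranSet (u : ℕ → 𝒜) : range (F.codingMap u) ⊆ F.moranSet u := by
  rintro _ ⟨i, rfl⟩
  exact mem_iInter.2 fun n => mem_iUnion.2 ⟨i, F.codingMap_mem u i n⟩

/-! ### The Moran measure of balls -/

theorem moranMeasure_range_compl (ω : ℕ → 𝒜 × Weights K) :
    F.moranMeasure ω (range (F.codingMap fun n => (ω n).1))ᶜ = 0 := by
  rw [moranMeasure, Measure.map_apply (F.measurable_codingMap _)
    (F.isClosed_range_codingMap _).measurableSet.compl]
  have : (F.codingMap fun n => (ω n).1) ⁻¹' (range (F.codingMap fun n => (ω n).1))ᶜ = ∅ := by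
    ext i; simp
  simp [this]

theorem measureReal_moranInterval (ω : ℕ → 𝒜 × Weights K) (i : ℕ → Fin K) (n : ℕ) :
    (F.moranMeasure ω).real (F.moranInterval (fun k => (ω k).1) i n) =
      ∏ k ∈ Finset.range n, (ω k).2 (i k) := by
  rw [measureReal_def, moranMeasure_moranInterval, ENNReal.toReal_prod]
  exact Finset.prod_congr rfl fun k _ => ENNReal.toReal_ofReal ((ω k).2.2.1 (i k))

theorem measureReal_ball_le (ω : ℕ → 𝒜 × Weights K) (i : ℕ → Fin K) (n : ℕ) {R : ℝ}
    (hR : R ≤ F.τ * F.cylinderLength (fun k => (ω k).1) i n) :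
    (F.moranMeasure ω).real (Metric.ball (F.codingMap (fun k => (ω k).1) i) R) ≤
      ∏ k ∈ Finset.range n, (ω k).2 (i k) := by
  rw [← measureReal_moranInterval]
  refine ENNReal.toReal_mono (measure_ne_top _ _) ?_
  rw [moranMeasure, Measure.map_apply (F.measurable_codingMap _) Metric.isOpen_ball.measurableSet,
    Measure.map_apply (F.measurable_codingMap _) (F.isClosed_moranInterval _ _ _).measurableSet]
  refine measure_mono fun j hj => ?_
  have hj' : dist (F.codingMap (fun k => (ω k).1) i) (F.codingMap (fun k => (ω k).1) j) < R := by
    rw [dist_comm]; exact hj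
  have hk := F.eq_of_dist_codingMap_lt _ (hj'.trans_le hR)
  have hm := F.codingMap_mem (fun k => (ω k).1) j n
  rwa [moranInterval, ← F.wordMap_congr _ hk] at hm

theorem le_measureReal_ball (ω : ℕ → 𝒜 × Weights K) (i : ℕ → Fin K) (n : ℕ) {r : ℝ}
    (hr : F.cylinderLength (fun k => (ω k).1) i n < r) :
    ∏ k ∈ Finset.range n, (ω k).2 (i k) ≤
      (F.moranMeasure ω).real (Metric.ball (F.codingMap (fun k => (ω k).1) i) r) := by
  rw [← measureReal_moranInterval]
  refine measureReal_mono (fun y hy => ?_)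
  exact (F.dist_le_of_mem_moranInterval _ i n hy (F.codingMap_mem _ i n)).trans_lt hr

theorem support_moranMeasure_subset (ω : ℕ → 𝒜 × Weights K) :
    (F.moranMeasure ω).support ⊆ range (F.codingMap fun n => (ω n).1) := by
  intro x hx
  by_contra h
  have := (Measure.mem_support_iff_forall x).1 hx _
    ((F.isClosed_range_codingMap fun n => (ω n).1).isOpen_compl.mem_nhds h)
  exact this.ne' (F.moranMeasure_range_compl ω)

theorem codingMap_mem_support (ω : ℕ → 𝒜 × Weights K) (i : ℕ → Fin K)
    (hpos : ∀ k, 0 < (ω k).2 (i k)) :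
    F.codingMap (fun n => (ω n).1) i ∈ (F.moranMeasure ω).support := by
  refine Metric.nhds_basis_ball.mem_measureSupport.2 fun r hr => ?_
  obtain ⟨n, hn⟩ :=
    ((F.tendsto_cylinderLength (fun k => (ω k).1) i).eventually (gt_mem_nhds hr)).exists
  have := (Finset.prod_pos fun k _ => hpos k).trans_le (F.le_measureReal_ball ω i n hn)
  exact (ENNReal.toReal_pos_iff.1 this).1

/-! ### The upper `Φ`-dimension of a Moran measure -/

theorem rpow_prod_mul_exp (u : ℕ → 𝒜) (i : ℕ → Fin K) (X : ℕ → ℝ) (d : ℝ) (n l : ℕ) :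
    (F.cylinderLength u i (n + l) / F.cylinderLength u i n) ^ d *
        Real.exp (-∑ k ∈ Finset.range l, X (n + k)) =
      ∏ k ∈ Finset.range l, (F.a (i (n + k)) (u (n + k)) ^ d * Real.exp (-X (n + k))) := by
  rw [cylinderLength_add, mul_div_cancel_left₀ _ (F.cylinderLength_pos u i n).ne',
    Finset.prod_mul_distrib, ← Real.finsetProd_rpow _ _ fun k _ => (F.a_pos _ _).le,
    ← Finset.sum_neg_distrib, Real.exp_sum]

theorem exp_mul_le_rpow {b q η : ℝ} {l : ℕ} (hη : 0 ≤ η) (hq : 0 < q) (hql : q ≤ b ^ l) :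
    Real.exp (η * -Real.log b * l) ≤ (1 / q) ^ η := by
  rw [Real.rpow_def_of_pos (by positivity), Real.exp_le_exp, one_div, Real.log_inv]
  have := Real.log_le_log hq hql
  rw [Real.log_pow] at this
  nlinarith

/-- The estimate that uses largeness of `Φ`. If `n` is the step of the scale `R` and `l` the number
of steps from the scale `R` to a scale `r < R ^ (1 + Φ R)`, then `l` is at least of the order of
`Φ R * |log R| = H R * log |log R|`, while `log (n + 1)` is at most of the order of
`log |log R|`. -/
theorem eventually_mul_log_le {Φ : ℝ → ℝ} (hΦ : IsLargeDimensionFunction Φ) {A B : ℝ} (hA : 0 < A)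
    (hA1 : A < 1) (hB : 0 < B) (hB1 : B < 1) (M : ℝ) :
    ∀ᶠ R in 𝓝[>] (0 : ℝ), ∀ r : ℝ, 0 < r → r < R ^ (1 + Φ R) → ∀ n l : ℕ, R ≤ B ^ n →
      A ^ l ≤ r / R → M * Real.log (n + 1) ≤ l := by
  obtain ⟨-, H, hH, hΦH⟩ := hΦ
  set a := -Real.log A with ha
  set c := -Real.log B with hc
  have ha0 : 0 < a := neg_pos.2 (Real.log_neg hA hA1)
  have hc0 : 0 < c := neg_pos.2 (Real.log_neg hB hB1)
  have hT : Tendsto (fun R => -Real.log R) (𝓝[>] (0 : ℝ)) atTop :=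
    tendsto_neg_atBot_atTop.comp Real.tendsto_log_nhdsGT_zero
  filter_upwards [hΦH, hH.eventually_ge_atTop (2 * max M 0 * a),
    hT.eventually_ge_atTop (1 / c + 2), self_mem_nhdsWithin] with R hR1 hR2 hR3 hR0
  intro r hr hrR n l hRn hl
  have hR0 : 0 < R := hR0
  set T := -Real.log R with hTdef
  have hic : 0 < 1 / c := by positivity
  have hT1 : 2 ≤ T := by linarith
  have hlogT : 0 ≤ Real.log T := Real.log_nonneg (by linarith)
  have habs : |Real.log R| = T := by
    rw [hTdef, abs_of_neg]; linarith
  have hn : n * c ≤ T := by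
    have := Real.log_le_log hR0 hRn
    rw [Real.log_pow] at this
    rw [hTdef, hc]; linarith
  have hn' : (n : ℝ) + 1 ≤ T ^ 2 := by
    have h1 : (n : ℝ) ≤ T * (1 / c) := by
      rw [mul_one_div, le_div_iff₀ hc0]; exact hn
    nlinarith
  have hlogn : Real.log (n + 1) ≤ 2 * Real.log T := by
    have := Real.log_le_log (by positivity) hn'
    rwa [Real.log_pow] at this
  have hΦT : Φ R * T = H R * Real.log T := by
    rw [hR1, habs]
    field_simp
  have hlen : H R * Real.log T ≤ l * a := by
    rw [← hΦT]
    have h1 : r / R < R ^ Φ R := by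
      rw [div_lt_iff₀ hR0]
      rwa [Real.rpow_add hR0, Real.rpow_one, mul_comm] at hrR
    have := Real.log_le_log (by positivity) (hl.trans h1.le)
    rw [Real.log_pow, Real.log_rpow hR0] at this
    rw [hTdef, ha]; linarith
  have hM : M * Real.log (n + 1) ≤ max M 0 * (2 * Real.log T) := by
    refine (mul_le_mul_of_nonneg_right (le_max_left M 0) ?_).trans
      (mul_le_mul_of_nonneg_left hlogn (le_max_right _ _))
    exact Real.log_nonneg (le_add_of_nonneg_left n.cast_nonneg)
  have h2 : 2 * max M 0 * a * Real.log T ≤ l * a :=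
    (mul_le_mul_of_nonneg_right hR2 hlogT).trans hlen
  have h3 : max M 0 * (2 * Real.log T) * a ≤ l * a := by linarith
  exact hM.trans (le_of_mul_le_mul_right h3 ha0)

theorem A_lt_one (i : Fin K) (u : 𝒜) : F.A < 1 := (F.A_le_B i u).trans_lt F.B_lt_one

theorem B_pos (i : Fin K) (u : 𝒜) : 0 < F.B := F.A_pos.trans_le (F.A_le_B i u)

theorem τ_le_one (i : Fin K) (u : 𝒜) : F.τ ≤ 1 := by
  have hK : (1 : ℝ) ≤ K := by exact_mod_cast (Nat.one_le_iff_ne_zero.2 i.pos.ne')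
  refine F.τ_le.trans ((div_le_one (by linarith)).2 ?_)
  linarith [F.B_pos i u]

theorem nonempty_of_weights (w : Weights K) : Nonempty (Fin K) := by
  by_contra h
  have := not_nonempty_iff.1 h
  have h1 := w.2.2
  simp at h1

variable {F} in
/-- If each weight is at least `a ^ d * exp (-X)`, where the block sums of `X` are negligible at the
scales `r < R ^ (1 + Φ R)`, then the mass of a Moran interval relative to an ancestor is at least
the `d`-th power of the relative length, up to an arbitrarily small change of the exponent. -/
theorem upperPhiDim_moranMeasure_le {ω : ℕ → 𝒜 × Weights K} {X : ℕ → ℝ} {d : ℝ} (hd : 0 ≤ d)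
    (hX : HasSublinearBlockSums X)
    (hw : ∀ n i, F.a i (ω n).1 ^ d * Real.exp (-X n) ≤ (ω n).2 i) {Φ : ℝ → ℝ}
    (hΦ : IsLargeDimensionFunction Φ) : upperPhiDim Φ (F.moranMeasure ω) ≤ (d : EReal) := by
  set u : ℕ → 𝒜 := fun n => (ω n).1 with hu
  have hwpos : ∀ n i, 0 < (ω n).2 i := fun n i =>
    (mul_pos (Real.rpow_pos_of_pos (F.a_pos _ _) _) (Real.exp_pos _)).trans_le (hw n i)
  obtain ⟨i₀⟩ := nonempty_of_weights (ω 0).2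
  have hA1 := F.A_lt_one i₀ (u 0)
  have hB0 := F.B_pos i₀ (u 0)
  have hτ1 := F.τ_le_one i₀ (u 0)
  have hA0 := F.A_pos
  have hτ0 := F.τ_pos
  by_contra! hlt
  obtain ⟨z, hdz, hz⟩ := EReal.lt_iff_exists_real_btwn.1 hlt
  refine hz.not_ge (sInf_le ⟨z, ?_, rfl⟩)
  obtain ⟨η, hη, rfl⟩ : ∃ η, 0 < η ∧ z = d + η :=
    ⟨z - d, sub_pos.2 (EReal.coe_lt_coe_iff.1 hdz), by ring⟩
  have hc0 : 0 < -Real.log F.B := neg_pos.2 (Real.log_neg hB0 F.B_lt_one)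
  obtain ⟨M, C, hMC⟩ := hX (η * -Real.log F.B) (by positivity)
  have hev := (eventually_mul_log_le hΦ F.A_pos hA1 hB0 F.B_lt_one M).and
    (eventually_nhdsWithin_of_eventually_nhds (gt_mem_nhds F.τ_pos))
  obtain ⟨δ, hδ0, hδ⟩ := mem_nhdsGT_iff_exists_Ioo_subset.1 hev
  have hδ0 : 0 < δ := hδ0
  set κ : ℝ := 1 / (F.τ * F.A ^ 2) with hκ
  have hκ0 : 0 < κ := by positivity
  refine ⟨min δ 1 / 2, Real.exp C * κ ^ (d + η), by positivity,
    by linarith [min_le_right δ 1], by positivity, ?_⟩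
  intro r R hr0 hrR hRR hR0 hRC x hx
  obtain ⟨hlog, hRτ⟩ := hδ (⟨hR0, by linarith [min_le_left δ 1]⟩ : R ∈ Ioo 0 δ)
  obtain ⟨i, rfl⟩ := F.support_moranMeasure_subset ω hx
  have hrltR : r < R := hrR.trans_le hRR
  set L := F.cylinderLength u i with hL
  have hLpos : ∀ k, 0 < L k := F.cylinderLength_pos u i
  have hLA : ∀ k, L k * F.A ≤ L (k + 1) := fun k => by
    simpa using F.le_cylinderLength_add u i k 1
  -- `n` is the step of the scale `R / τ`, and `m + 1` that of the scale `r`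
  obtain ⟨n, hn1, hn2⟩ := F.exists_cylinderLength_lt_le u i (ρ := R / F.τ) (by positivity)
    ((div_le_one F.τ_pos).2 hRτ.le)
  obtain ⟨m, hm1, hm2⟩ := F.exists_cylinderLength_lt_le u i (ρ := r) hr0
    (by linarith)
  have hRLn : R ≤ L n := le_trans (by rw [le_div_iff₀ hτ0]; nlinarith) hn2
  obtain ⟨l, hl⟩ : ∃ l, m + 1 = n + l := by
    refine Nat.exists_eq_add_of_le (le_of_not_gt fun h => ?_)
    have := F.cylinderLength_antitone u i h.le
    rw [← hL] at this
    linarith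
  rw [hl] at hm1
  set q := L (n + l) / L n with hq
  have hq0 : 0 < q := div_pos (hLpos _) (hLpos _)
  have hqB : q ≤ F.B ^ l := by
    rw [hq, div_le_iff₀' (hLpos n)]
    exact F.cylinderLength_add_le u i n l
  have hqA : F.A ^ l ≤ q := by
    rw [hq, le_div_iff₀' (hLpos n)]
    exact F.le_cylinderLength_add u i n l
  have hqr : q ≤ r / R := div_le_div₀ hr0.le hm1.le hR0 hRLn
  have hqκ : 1 / q ≤ κ * (R / r) := by
    have h1 : r * F.A ≤ L (n + l) := by
      rw [← hl]
      exact (mul_le_mul_of_nonneg_right hm2 F.A_pos.le).trans (hLA m)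
    have h2 : L n ≤ R / F.τ / F.A := by
      rw [le_div_iff₀ F.A_pos]
      exact (hLA n).trans hn1.le
    have h3 : 1 / q = L n / L (n + l) := by rw [hq, one_div_div]
    rw [h3]
    refine (div_le_div₀ (by positivity) h2 (by positivity) h1).trans_eq ?_
    rw [hκ]
    field_simp
  have hblock := hMC n l (hlog r hr0 hrR n l (hRLn.trans (F.cylinderLength_le_pow u i n))
    (hqA.trans hqr))
  have hnum := F.measureReal_ball_le ω i n (R := R) (by
    have := (div_le_iff₀' F.τ_pos).1 hn2
    exact this)
  have hden := F.le_measureReal_ball ω i (n + l) (r := r) hm1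
  rw [Finset.prod_range_add] at hden
  have hprod : q ^ d * Real.exp (-∑ k ∈ Finset.range l, X (n + k)) ≤
      ∏ k ∈ Finset.range l, (ω (n + k)).2 (i (n + k)) := by
    rw [hq, hL, F.rpow_prod_mul_exp]
    exact Finset.prod_le_prod (fun k _ => mul_nonneg (Real.rpow_nonneg (F.a_pos _ _).le _)
      (Real.exp_pos _).le) fun k _ => hw _ _
  have hPn : 0 < ∏ k ∈ Finset.range n, (ω k).2 (i k) := Finset.prod_pos fun k _ => hwpos _ _
  have hlow : q ^ d * Real.exp (-(η * -Real.log F.B * l + C)) ≤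
      ∏ k ∈ Finset.range l, (ω (n + k)).2 (i (n + k)) := by
    refine le_trans (mul_le_mul_of_nonneg_left (Real.exp_le_exp.2 ?_)
      (Real.rpow_nonneg hq0.le d)) hprod
    linarith [(abs_le.1 hblock).2]
  have hlow0 : 0 < q ^ d * Real.exp (-(η * -Real.log F.B * l + C)) := by positivity
  calc _ ≤ (∏ k ∈ Finset.range n, (ω k).2 (i k)) / ((∏ k ∈ Finset.range n, (ω k).2 (i k)) *
        (q ^ d * Real.exp (-(η * -Real.log F.B * l + C)))) :=
        div_le_div₀ hPn.le hnum (mul_pos hPn hlow0)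
          ((mul_le_mul_of_nonneg_left hlow hPn.le).trans hden)
    _ = Real.exp C * ((1 / q) ^ d * Real.exp (η * -Real.log F.B * l)) := by
        rw [Real.exp_neg, Real.exp_add, one_div q, Real.inv_rpow hq0.le]
        field_simp
    _ ≤ Real.exp C * ((1 / q) ^ d * (1 / q) ^ η) := by
        gcongr
        exact exp_mul_le_rpow hη.le hq0 hqB
    _ = Real.exp C * (1 / q) ^ (d + η) := by rw [Real.rpow_add (by positivity)]
    _ ≤ Real.exp C * (κ * (R / r)) ^ (d + η) := by gcongr
    _ = Real.exp C * κ ^ (d + η) * (R / r) ^ (d + η) := by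
        rw [Real.mul_rpow hκ0.le (by positivity), mul_assoc]

variable {F} in
/-- Along the code `i` the mass of Moran intervals is comparable with the `d`-th power of the
length, up to negligible block sums, so that no exponent smaller than `d` is possible. Fixing `R`
and letting `r → 0` is enough for this. -/
theorem le_upperPhiDim_moranMeasure {ω : ℕ → 𝒜 × Weights K} {X : ℕ → ℝ} {d : ℝ}
    (hX : HasSublinearBlockSums X) (i : ℕ → Fin K)
    (hw : ∀ n, (ω n).2 (i n) = F.a (i n) (ω n).1 ^ d * Real.exp (-X n)) {Φ : ℝ → ℝ}
    (hΦ : IsDimensionFunction Φ) : (d : EReal) ≤ upperPhiDim Φ (F.moranMeasure ω) := by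
  set u : ℕ → 𝒜 := fun n => (ω n).1 with hu
  have hwpos : ∀ n, 0 < (ω n).2 (i n) := fun n => by
    rw [hw]; exact mul_pos (Real.rpow_pos_of_pos (F.a_pos _ _) _) (Real.exp_pos _)
  have hB0 := F.B_pos (i 0) (u 0)
  have hτ0 := F.τ_pos
  have hτ1 := F.τ_le_one (i 0) (u 0)
  refine le_sInf ?_
  rintro _ ⟨d', ⟨C₁, C₂, hC₁, hC₁1, hC₂, hmain⟩, rfl⟩
  rw [EReal.coe_le_coe_iff]
  by_contra! hlt
  set η := (d - d') / 2 with hη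
  have hη0 : 0 < η := by rw [hη]; linarith
  have hc0 : 0 < -Real.log F.B := neg_pos.2 (Real.log_neg hB0 F.B_lt_one)
  set ε := η * -Real.log F.B with hε
  have hε0 : 0 < ε := by positivity
  obtain ⟨M, C, hMC⟩ := hX ε hε0
  set L := F.cylinderLength u i with hL
  have hLpos : ∀ k, 0 < L k := F.cylinderLength_pos u i
  have hLlim : Tendsto L atTop (𝓝 0) := F.tendsto_cylinderLength u i
  obtain ⟨n, hn⟩ := (hLlim.eventually (gt_mem_nhds (half_pos hC₁))).exists
  -- the ball of radius `R` contains a Moran interval of step `n`, and the ball of radius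
  -- `τ * L (n + l)` carries no more mass than one of step `n + l`
  set R := 2 * L n with hR
  have hR0 : 0 < R := mul_pos two_pos (hLpos n)
  have hR1 : R < 1 := by linarith
  have hPn : 0 < ∏ k ∈ Finset.range n, (ω k).2 (i k) := Finset.prod_pos fun k _ => hwpos _
  have hbound : ∀ᶠ l : ℕ in atTop, Real.exp (ε * l) ≤
      Real.exp C * (C₂ * (2 / F.τ) ^ d') := by
    have hr : ∀ᶠ l : ℕ in atTop, F.τ * L (l + n) < R ^ (1 + Φ R) := by
      have h1 : Tendsto (fun l => F.τ * L (l + n)) atTop (𝓝 0) := by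
        simpa using ((tendsto_add_atTop_iff_nat n).2 hLlim).const_mul F.τ
      exact h1.eventually (gt_mem_nhds (Real.rpow_pos_of_pos hR0 _))
    filter_upwards [hr, tendsto_natCast_atTop_atTop.eventually_ge_atTop (M * Real.log (n + 1))]
      with l hl1 hl2
    rw [add_comm l n] at hl1
    have hr0 : 0 < F.τ * L (n + l) := mul_pos hτ0 (hLpos _)
    have hRR : R ^ (1 + Φ R) ≤ R := by
      have := Real.rpow_le_rpow_of_exponent_ge hR0 hR1.le
        (show (1 : ℝ) ≤ 1 + Φ R by linarith [hΦ.nonneg R ⟨hR0, hR1⟩])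
      rwa [Real.rpow_one] at this
    have hfin := hmain _ R hr0 hl1 hRR hR0 (by linarith) _ (F.codingMap_mem_support ω i hwpos)
    set q := L (n + l) / L n with hq
    have hq0 : 0 < q := div_pos (hLpos _) (hLpos _)
    have hqB : q ≤ F.B ^ l := by
      rw [hq, div_le_iff₀' (hLpos n)]
      exact F.cylinderLength_add_le u i n l
    have hnum := F.le_measureReal_ball ω i n (r := R) (by linarith [hLpos n])
    have hden := F.measureReal_ball_le ω i (n + l) (R := F.τ * L (n + l)) le_rfl
    have hden0 : 0 < (F.moranMeasure ω).real
        (Metric.ball (F.codingMap u i) (F.τ * L (n + l))) := by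
      rw [measureReal_def, ENNReal.toReal_pos_iff]
      exact ⟨Metric.nhds_basis_ball.mem_measureSupport.1 (F.codingMap_mem_support ω i hwpos) _ hr0,
        measure_lt_top _ _⟩
    have hprod : ∏ k ∈ Finset.range l, (ω (n + k)).2 (i (n + k)) =
        q ^ d * Real.exp (-∑ k ∈ Finset.range l, X (n + k)) := by
      rw [hq, hL, F.rpow_prod_mul_exp]
      exact Finset.prod_congr rfl fun k _ => hw _
    rw [Finset.prod_range_add, hprod] at hden
    have hsum : -(ε * l + C) ≤ ∑ k ∈ Finset.range l, X (n + k) := (abs_le.1 (hMC n l hl2)).1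
    have hexp := exp_mul_le_rpow (l := l) hη0.le hq0 hqB
    have hratio : (1 / q) ^ d * Real.exp (-(ε * l + C)) ≤ C₂ * (R / (F.τ * L (n + l))) ^ d' := by
      refine le_trans ?_ hfin
      rw [le_div_iff₀ hden0]
      refine le_trans ?_ hnum
      refine (mul_le_mul_of_nonneg_left hden (by positivity)).trans ?_
      have hqd : (1 / q) ^ d * q ^ d = 1 := by
        rw [← Real.mul_rpow (by positivity) hq0.le, one_div_mul_cancel hq0.ne', Real.one_rpow]
      have hone : Real.exp (-(ε * l + C)) * Real.exp (-∑ k ∈ Finset.range l, X (n + k)) ≤ 1 := by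
        rw [← Real.exp_add, Real.exp_le_one_iff]; linarith
      calc _ = (∏ k ∈ Finset.range n, (ω k).2 (i k)) * ((1 / q) ^ d * q ^ d) *
            (Real.exp (-(ε * l + C)) * Real.exp (-∑ k ∈ Finset.range l, X (n + k))) := by ring
        _ ≤ _ := by
          rw [hqd, mul_one]
          exact mul_le_of_le_one_right hPn.le hone
    have hRq : R / (F.τ * L (n + l)) = 2 / F.τ * (1 / q) := by
      rw [hR, hq]
      have := hLpos n; have := hLpos (n + l)
      field_simp
    rw [hRq, Real.mul_rpow (by positivity) (by positivity)] at hratio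
    have hsplit : (1 / q) ^ d = (1 / q) ^ d' * ((1 / q) ^ η * (1 / q) ^ η) := by
      rw [← Real.rpow_add (by positivity), ← Real.rpow_add (by positivity)]
      congr 1; rw [hη]; ring
    have hqd' : 0 < (1 / q) ^ d' := by positivity
    have h1 : (1 / q) ^ η * (1 / q) ^ η * Real.exp (-(ε * l + C)) ≤ C₂ * (2 / F.τ) ^ d' := by
      refine le_of_mul_le_mul_left ?_ hqd'
      rw [hsplit] at hratio
      linarith
    calc Real.exp (ε * l) = Real.exp C * (Real.exp (ε * l) * Real.exp (ε * l) *
          Real.exp (-(ε * l + C))) := by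
          simp only [← Real.exp_add]; congr 1; ring
      _ ≤ Real.exp C * ((1 / q) ^ η * (1 / q) ^ η * Real.exp (-(ε * l + C))) := by gcongr
      _ ≤ _ := by gcongr
  have hlim : Tendsto (fun l : ℕ => Real.exp (ε * l)) atTop atTop :=
    Real.tendsto_exp_atTop.comp (tendsto_natCast_atTop_atTop.const_mul_atTop hε0)
  obtain ⟨l, hl1, hl2⟩ := (hbound.and (hlim.eventually_gt_atTop _)).exists
  exact hl2.not_ge hl1

/-! ### The Hausdorff dimension of a Moran set -/

theorem ediam_moranInterval_le (u : ℕ → 𝒜) (i : ℕ → Fin K) (n : ℕ) :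
    Metric.ediam (F.moranInterval u i n) ≤ ENNReal.ofReal (F.cylinderLength u i n) := by
  refine Metric.ediam_le fun x hx y hy => ?_
  rw [edist_dist]
  exact ENNReal.ofReal_le_ofReal (F.dist_le_of_mem_moranInterval u i n hx hy)

variable {F} in
/-- The Moran intervals of step `n` cover the Moran set, and the sum of the `D`-th powers of their
lengths is the product of the sums `∑ j, a j ^ D` of the first `n` steps, hence subexponential. -/
theorem dimH_moranSet_le (i₀ : Fin K) {u : ℕ → 𝒜} {D : ℝ≥0}
    (hX : HasSublinearBlockSums fun n => Real.log (∑ j, F.a j (u n) ^ (D : ℝ))) :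
    dimH (F.moranSet u) ≤ D := by
  by_contra! hlt
  obtain ⟨s, hDs, hs⟩ := ENNReal.lt_iff_exists_nnreal_btwn.1 hlt
  have hDs : (D : ℝ) < s := by exact_mod_cast hDs
  refine hs.not_ge (dimH_le_of_hausdorffMeasure_ne_top ?_)
  have hB0 := F.B_pos i₀ (u 0)
  have hc0 : 0 < -Real.log F.B := neg_pos.2 (Real.log_neg hB0 F.B_lt_one)
  set ε := ((s : ℝ) - D) * -Real.log F.B / 2 with hε
  have hε0 : 0 < ε := by
    have : 0 < (s : ℝ) - D := by linarith
    positivity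
  obtain ⟨M, C, hMC⟩ := hX ε hε0
  -- an infinite word that begins with a given finite one
  let e : (n : ℕ) → (Fin n → Fin K) → ℕ → Fin K := fun n w k => if h : k < n then w ⟨k, h⟩ else i₀
  have hcover : ∀ n, F.moranSet u ⊆ ⋃ w : Fin n → Fin K, F.moranInterval u (e n w) n := by
    intro n x hx
    obtain ⟨i, hi⟩ := mem_iUnion.1 (mem_iInter.1 hx n)
    refine mem_iUnion.2 ⟨fun k => i k, ?_⟩
    rwa [moranInterval, F.wordMap_congr u (j := i)]
    intro k hk
    simp [e, hk]
  have hsum : ∀ n, ∑ w : Fin n → Fin K, Metric.ediam (F.moranInterval u (e n w) n) ^ (s : ℝ) ≤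
      ENNReal.ofReal (Real.exp (C - ε * n)) := by
    intro n
    have h1 : ∀ w : Fin n → Fin K, Metric.ediam (F.moranInterval u (e n w) n) ^ (s : ℝ) ≤
        ENNReal.ofReal (F.cylinderLength u (e n w) n ^ (D : ℝ) * Real.exp (-(2 * ε) * n)) := by
      intro w
      have hL0 := F.cylinderLength_pos u (e n w) n
      refine (ENNReal.rpow_le_rpow (F.ediam_moranInterval_le u _ n) s.coe_nonneg).trans ?_
      rw [ENNReal.ofReal_rpow_of_pos hL0]
      refine ENNReal.ofReal_le_ofReal ?_
      rw [show (s : ℝ) = D + (s - D) by ring, Real.rpow_add hL0]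
      refine mul_le_mul_of_nonneg_left ?_ (by positivity)
      refine (Real.rpow_le_rpow hL0.le (F.cylinderLength_le_pow u _ n) (by linarith)).trans_eq ?_
      rw [← Real.rpow_natCast, ← Real.rpow_mul hB0.le, Real.rpow_def_of_pos hB0, hε]
      congr 1; ring
    refine (Finset.sum_le_sum fun w _ => h1 w).trans ?_
    rw [← ENNReal.ofReal_sum_of_nonneg fun w _ => mul_nonneg
      (Real.rpow_nonneg (F.cylinderLength_pos u _ n).le _) (Real.exp_pos _).le]
    refine ENNReal.ofReal_le_ofReal ?_
    rw [← Finset.sum_mul]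
    have h2 : ∑ w : Fin n → Fin K, F.cylinderLength u (e n w) n ^ (D : ℝ) =
        Real.exp (∑ k ∈ Finset.range n, Real.log (∑ j, F.a j (u k) ^ (D : ℝ))) := by
      have hlog : ∀ k, Real.exp (Real.log (∑ j, F.a j (u k) ^ (D : ℝ))) =
          ∑ j, F.a j (u k) ^ (D : ℝ) := fun k => Real.exp_log (Finset.sum_pos
        (fun j _ => Real.rpow_pos_of_pos (F.a_pos j (u k)) _) ⟨i₀, Finset.mem_univ _⟩)
      simp only [Real.exp_sum, hlog]
      rw [Finset.prod_range, Finset.prod_univ_sum, Fintype.piFinset_univ]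
      refine Finset.sum_congr rfl fun w _ => ?_
      rw [cylinderLength, ← Real.finsetProd_rpow _ _ fun k _ => (F.a_pos _ _).le,
        Finset.prod_range]
      refine Finset.prod_congr rfl fun k _ => ?_
      simp [e]
    rw [h2, ← Real.exp_add, Real.exp_le_exp]
    have := (abs_le.1 (hMC 0 n (by simp))).2
    simp only [zero_add] at this
    linarith
  have hlim : Tendsto (fun n : ℕ => ENNReal.ofReal (Real.exp (C - ε * n))) atTop (𝓝 0) := by
    rw [← ENNReal.ofReal_zero]
    refine ENNReal.tendsto_ofReal (Real.tendsto_exp_atBot.comp ?_)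
    exact tendsto_const_nhds.add_atBot
      (tendsto_neg_atTop_atBot.comp (tendsto_natCast_atTop_atTop.const_mul_atTop hε0))
  have hBn : Tendsto (fun n : ℕ => ENNReal.ofReal (F.B ^ n)) atTop (𝓝 0) := by
    rw [← ENNReal.ofReal_zero]
    exact ENNReal.tendsto_ofReal (tendsto_pow_atTop_nhds_zero_of_lt_one hB0.le F.B_lt_one)
  have hle := Measure.hausdorffMeasure_le_liminf_sum (s : ℝ) (F.moranSet u) _ hBn
    (fun n w => F.moranInterval u (e n w) n)
    (Eventually.of_forall fun n w => (F.ediam_moranInterval_le u _ n).trans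
      (ENNReal.ofReal_le_ofReal (F.cylinderLength_le_pow u _ n)))
    (Eventually.of_forall hcover)
  have hzero := tendsto_of_tendsto_of_tendsto_of_le_of_le tendsto_const_nhds hlim
    (fun n => zero_le) hsum
  rw [hzero.liminf_eq] at hle
  exact (hle.trans_lt ENNReal.zero_lt_top).ne

variable {F} in
/-- If each weight is at most `a ^ D * exp (-X)` with negligible block sums of `X`, then the mass
of a ball of radius `R` is at most of the order of `R ^ t` for each `t < D`. -/
theorem exists_measureReal_ball_le_rpow {ω : ℕ → 𝒜 × Weights K} {X : ℕ → ℝ} {D t : ℝ}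
    (hX : HasSublinearBlockSums X)
    (hw : ∀ n i, (ω n).2 i ≤ F.a i (ω n).1 ^ D * Real.exp (-X n)) (ht : 0 ≤ t) (htD : t < D) :
    ∃ c : ℝ, 0 < c ∧ ∀ i : ℕ → Fin K, ∀ R : ℝ, 0 < R → R ≤ F.τ →
      (F.moranMeasure ω).real (Metric.ball (F.codingMap (fun n => (ω n).1) i) R) ≤ c * R ^ t := by
  set u : ℕ → 𝒜 := fun n => (ω n).1 with hu
  obtain ⟨i₀⟩ := nonempty_of_weights (ω 0).2
  have hB0 := F.B_pos i₀ (u 0)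
  have hA0 := F.A_pos
  have hτ0 := F.τ_pos
  have hc0 : 0 < -Real.log F.B := neg_pos.2 (Real.log_neg hB0 F.B_lt_one)
  have hη0 : 0 < D - t := sub_pos.2 htD
  obtain ⟨M, C, hMC⟩ := hX ((D - t) * -Real.log F.B) (by positivity)
  refine ⟨Real.exp C * (1 / (F.τ * F.A)) ^ t, by positivity, fun i R hR0 hRτ => ?_⟩
  obtain ⟨n, hn1, hn2⟩ := F.exists_cylinderLength_lt_le u i (ρ := R / F.τ) (by positivity)
    ((div_le_one F.τ_pos).2 hRτ)
  have hL0 := F.cylinderLength_pos u i n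
  have hexp := exp_mul_le_rpow hη0.le hL0 (F.cylinderLength_le_pow u i n)
  have hblock := (abs_le.1 (hMC 0 n (by simp))).1
  have hprod := F.rpow_prod_mul_exp u i X D 0 n
  simp only [zero_add, cylinderLength_zero, div_one] at hprod hblock
  have hLR : F.cylinderLength u i n ≤ 1 / (F.τ * F.A) * R := by
    have h1 := F.le_cylinderLength_add u i n 1
    rw [pow_one] at h1
    have h2 := (le_div_iff₀ F.A_pos).2 (h1.trans hn1.le)
    refine h2.trans_eq ?_
    field_simp
  calc _ ≤ ∏ k ∈ Finset.range n, (ω k).2 (i k) :=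
        F.measureReal_ball_le ω i n ((div_le_iff₀' F.τ_pos).1 hn2)
    _ ≤ ∏ k ∈ Finset.range n, (F.a (i k) (u k) ^ D * Real.exp (-X k)) :=
        Finset.prod_le_prod (fun k _ => (ω k).2.2.1 _) fun k _ => hw _ _
    _ = F.cylinderLength u i n ^ D * Real.exp (-∑ k ∈ Finset.range n, X k) := hprod.symm
    _ ≤ F.cylinderLength u i n ^ D *
          (Real.exp C * Real.exp ((D - t) * -Real.log F.B * n)) := by
        rw [← Real.exp_add]
        gcongr
        linarith
    _ ≤ F.cylinderLength u i n ^ D *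
          (Real.exp C * (1 / F.cylinderLength u i n) ^ (D - t)) := by gcongr
    _ = Real.exp C * F.cylinderLength u i n ^ t := by
        rw [one_div, Real.inv_rpow hL0.le, Real.rpow_sub hL0]
        field_simp
    _ ≤ Real.exp C * (1 / (F.τ * F.A) * R) ^ t := by gcongr
    _ = _ := by rw [Real.mul_rpow (by positivity) hR0.le, mul_assoc]

variable {F} in
/-- The mass distribution principle for the Moran measure. -/
theorem le_dimH_moranSet {ω : ℕ → 𝒜 × Weights K} {X : ℕ → ℝ} {D : ℝ≥0}
    (hX : HasSublinearBlockSums X)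
    (hw : ∀ n i, (ω n).2 i ≤ F.a i (ω n).1 ^ (D : ℝ) * Real.exp (-X n)) :
    D ≤ dimH (F.moranSet fun n => (ω n).1) := by
  by_contra! hlt
  obtain ⟨t, htdim, htD⟩ := ENNReal.lt_iff_exists_nnreal_btwn.1 hlt
  have htD : (t : ℝ) < D := by exact_mod_cast htD
  refine htdim.not_ge (le_dimH_of_hausdorffMeasure_ne_zero ?_)
  obtain ⟨c, hc, hball⟩ := exists_measureReal_ball_le_rpow hX hw t.coe_nonneg htD
  set μ := F.moranMeasure ω
  have hτ0 := F.τ_pos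
  have hset : ∀ s : Set ℝ, Metric.ediam s ≤ ENNReal.ofReal (F.τ / 2) →
      μ s ≤ ENNReal.ofReal c * Metric.ediam s ^ (t : ℝ) := by
    intro s hs
    by_cases hx : (s ∩ range (F.codingMap fun n => (ω n).1)).Nonempty
    · obtain ⟨x, hxs, i, rfl⟩ := hx
      have hfin : Metric.ediam s ≠ ∞ := (hs.trans_lt ENNReal.ofReal_lt_top).ne
      set ρ := (Metric.ediam s).toReal with hρ
      have hρτ : ρ < F.τ := by
        have := ENNReal.toReal_le_of_le_ofReal (by positivity) hs
        linarith
      have hρ0 : 0 ≤ ρ := ENNReal.toReal_nonneg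
      -- `ρ` may be `0`, so the estimate is applied to radii `R > ρ` and passed to the limit
      have hR : ∀ R ∈ Ioo ρ F.τ, μ s ≤ ENNReal.ofReal (c * R ^ (t : ℝ)) := by
        intro R hR
        refine le_trans (measure_mono fun y hy => ?_) (ENNReal.le_ofReal_iff_toReal_le
          (measure_ne_top _ _) (mul_nonneg hc.le (Real.rpow_nonneg (hρ0.trans hR.1.le) _))
          |>.2 (hball i R (hρ0.trans_lt hR.1) hR.2.le))
        exact (Metric.dist_le_diam_of_mem' hfin hy hxs).trans_lt hR.1
      have hlim : Tendsto (fun R => ENNReal.ofReal (c * R ^ (t : ℝ))) (𝓝[>] ρ)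
          (𝓝 (ENNReal.ofReal (c * ρ ^ (t : ℝ)))) := by
        refine ENNReal.tendsto_ofReal (Tendsto.const_mul c ?_)
        exact (Real.continuous_rpow_const t.coe_nonneg).continuousAt.tendsto.mono_left
          nhdsWithin_le_nhds
      refine (ge_of_tendsto hlim (mem_of_superset (Ioo_mem_nhdsGT hρτ) hR)).trans_eq ?_
      rw [ENNReal.ofReal_mul hc.le, ← ENNReal.ofReal_rpow_of_nonneg hρ0 t.coe_nonneg, hρ,
        ENNReal.ofReal_toReal hfin]
    · have h0 : μ s = 0 := measure_mono_null
        (disjoint_iff_inter_eq_empty.2 (not_nonempty_iff_eq_empty.1 hx)).subset_compl_right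
        (F.moranMeasure_range_compl ω)
      rw [h0]; exact zero_le
  have hc' : ENNReal.ofReal c ≠ 0 := (ENNReal.ofReal_pos.2 hc).ne'
  have hle : (ENNReal.ofReal c)⁻¹ • μ ≤ Measure.hausdorffMeasure (t : ℝ) := by
    refine Measure.le_hausdorffMeasure _ _ (ENNReal.ofReal (F.τ / 2)) (by simpa using hτ0)
      fun s hs => ?_
    rw [Measure.smul_apply, smul_eq_mul, ENNReal.inv_mul_le_iff hc' ENNReal.ofReal_ne_top]
    exact hset s hs
  have hone : μ (F.moranSet fun n => (ω n).1) = 1 := by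
    refine le_antisymm prob_le_one ?_
    rw [← (prob_compl_eq_zero_iff (F.isClosed_range_codingMap _).measurableSet).1
      (F.moranMeasure_range_compl ω)]
    exact measure_mono (F.range_codingMap_subset_moranSet _)
  have := hle (F.moranSet fun n => (ω n).1)
  rw [Measure.smul_apply, hone, smul_eq_mul, mul_one] at this
  exact ((ENNReal.inv_pos.2 ENNReal.ofReal_ne_top).trans_le this).ne'

/-! ### The mean pressure and the choice of the weights -/

/-- The logarithm of the sum of the `s`-th powers of the scaling ratios. -/
noncomputable def pressure (s : ℝ) (u : 𝒜) : ℝ := Real.log (∑ j, F.a j u ^ s)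

/-- The expectation of the pressure at `s`; the almost sure dimension of the Moran set is its
zero as a function of `s`. -/
noncomputable def meanPressure (Q : Measure 𝒜) (s : ℝ) : ℝ := ∫ u, F.pressure s u ∂Q

theorem sum_rpow_pos (i₀ : Fin K) (s : ℝ) (u : 𝒜) : 0 < ∑ j, F.a j u ^ s :=
  Finset.sum_pos (fun j _ => Real.rpow_pos_of_pos (F.a_pos j u) _) ⟨i₀, Finset.mem_univ _⟩

theorem sum_rpow_le {s : ℝ} (hs : 0 ≤ s) (u : 𝒜) : ∑ j, F.a j u ^ s ≤ K := by
  refine (Finset.sum_le_sum fun j _ => Real.rpow_le_one (F.a_pos j u).le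
    ((F.a_le_B j u).trans F.B_lt_one.le) hs).trans_eq ?_
  simp

theorem measurable_pressure (s : ℝ) : Measurable (F.pressure s) :=
  (Finset.measurable_sum _ fun j _ => (F.measurable_a j).pow_const s).log

theorem exists_abs_pressure_le (i₀ : Fin K) {s : ℝ} (hs : 0 ≤ s) :
    ∃ b, ∀ u, |F.pressure s u| ≤ b := by
  refine ⟨max (Real.log K) (-Real.log (F.A ^ s)), fun u => abs_le'.2 ⟨?_, ?_⟩⟩
  · exact (Real.log_le_log (F.sum_rpow_pos i₀ s u) (F.sum_rpow_le hs u)).trans (le_max_left _ _)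
  · refine le_trans (neg_le_neg (Real.log_le_log (Real.rpow_pos_of_pos F.A_pos s) ?_))
      (le_max_right _ _)
    exact (Real.rpow_le_rpow F.A_pos.le (F.A_le i₀ u) hs).trans
      (Finset.single_le_sum (f := fun j => F.a j u ^ s)
        (fun j _ => Real.rpow_nonneg (F.a_pos j u).le s) (Finset.mem_univ i₀))

theorem pressure_le_add (i₀ : Fin K) {s t : ℝ} (hst : s ≤ t) (u : 𝒜) :
    F.pressure t u ≤ F.pressure s u + (t - s) * Real.log F.B := by
  have hB := F.B_pos i₀ u
  rw [pressure, pressure, mul_comm, ← Real.log_exp (Real.log F.B * (t - s)),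
    ← Real.rpow_def_of_pos hB, ← Real.log_mul (F.sum_rpow_pos i₀ s u).ne'
      (Real.rpow_pos_of_pos hB _).ne', Finset.sum_mul]
  refine Real.log_le_log (F.sum_rpow_pos i₀ t u) (Finset.sum_le_sum fun j _ => ?_)
  have hj := F.a_pos j u
  rw [← sub_add_cancel t s, Real.rpow_add hj, mul_comm, sub_add_cancel]
  gcongr
  exact F.a_le_B j u

theorem add_le_pressure (i₀ : Fin K) {s t : ℝ} (hst : s ≤ t) (u : 𝒜) :
    F.pressure s u + (t - s) * Real.log F.A ≤ F.pressure t u := by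
  have hA := F.A_pos
  rw [pressure, pressure, mul_comm (t - s), ← Real.log_exp (Real.log F.A * (t - s)),
    ← Real.rpow_def_of_pos hA, ← Real.log_mul (F.sum_rpow_pos i₀ s u).ne'
      (Real.rpow_pos_of_pos hA _).ne', Finset.sum_mul]
  refine Real.log_le_log (Finset.sum_pos (fun j _ => mul_pos (Real.rpow_pos_of_pos (F.a_pos j u) _)
    (Real.rpow_pos_of_pos hA _)) ⟨i₀, Finset.mem_univ _⟩) (Finset.sum_le_sum fun j _ => ?_)
  have hj := F.a_pos j u
  rw [← sub_add_cancel t s, Real.rpow_add hj, mul_comm (F.a j u ^ (t - s)), sub_add_cancel]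
  gcongr
  exact F.A_le j u

theorem integrable_pressure (i₀ : Fin K) (Q : Measure 𝒜) [IsProbabilityMeasure Q] {s : ℝ}
    (hs : 0 ≤ s) : Integrable (F.pressure s) Q := by
  obtain ⟨b, hb⟩ := F.exists_abs_pressure_le i₀ hs
  exact Integrable.of_bound (F.measurable_pressure s).aestronglyMeasurable b (ae_of_all _ hb)

theorem meanPressure_le_add (i₀ : Fin K) (Q : Measure 𝒜) [IsProbabilityMeasure Q] {s t : ℝ}
    (hs : 0 ≤ s) (hst : s ≤ t) :
    F.meanPressure Q t ≤ F.meanPressure Q s + (t - s) * Real.log F.B := by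
  have h := integral_mono (μ := Q) (F.integrable_pressure i₀ Q (hs.trans hst))
    ((F.integrable_pressure i₀ Q hs).add (integrable_const _)) (F.pressure_le_add i₀ hst)
  have hadd := integral_add (F.integrable_pressure i₀ Q hs)
    (integrable_const (μ := Q) ((t - s) * Real.log F.B))
  rw [integral_const, probReal_univ, one_smul] at hadd
  exact h.trans_eq hadd

theorem add_le_meanPressure (i₀ : Fin K) (Q : Measure 𝒜) [IsProbabilityMeasure Q] {s t : ℝ}
    (hs : 0 ≤ s) (hst : s ≤ t) :
    F.meanPressure Q s + (t - s) * Real.log F.A ≤ F.meanPressure Q t := by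
  have h := integral_mono (μ := Q) ((F.integrable_pressure i₀ Q hs).add (integrable_const _))
    (F.integrable_pressure i₀ Q (hs.trans hst)) (F.add_le_pressure i₀ hst)
  have hadd := integral_add (F.integrable_pressure i₀ Q hs)
    (integrable_const (μ := Q) ((t - s) * Real.log F.A))
  rw [integral_const, probReal_univ, one_smul] at hadd
  exact hadd.symm.trans_le h

theorem log_B_neg (i₀ : Fin K) (u : 𝒜) : Real.log F.B < 0 :=
  Real.log_neg (F.B_pos i₀ u) F.B_lt_one

theorem meanPressure_antitoneOn (i₀ : Fin K) (Q : Measure 𝒜) [IsProbabilityMeasure Q] :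
    AntitoneOn (F.meanPressure Q) (Ici 0) := by
  obtain ⟨u⟩ := nonempty_of_isProbabilityMeasure Q
  intro s hs t _ hst
  have := F.meanPressure_le_add i₀ Q hs hst
  nlinarith [F.log_B_neg i₀ u]

theorem continuousOn_meanPressure (i₀ : Fin K) (Q : Measure 𝒜) [IsProbabilityMeasure Q] :
    ContinuousOn (F.meanPressure Q) (Ici 0) := by
  have key : ∀ s t : ℝ, 0 ≤ s → s ≤ t →
      |F.meanPressure Q s - F.meanPressure Q t| ≤ |Real.log F.A| * |s - t| := by
    intro s t hs hst
    have h1 := F.add_le_meanPressure i₀ Q hs hst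
    have h2 := F.meanPressure_antitoneOn i₀ Q hs (hs.trans hst) hst
    rw [abs_of_nonneg (sub_nonneg.2 h2), abs_sub_comm s t, abs_of_nonneg (sub_nonneg.2 hst)]
    nlinarith [neg_le_abs (Real.log F.A)]
  refine (LipschitzOnWith.of_dist_le_mul (K := ⟨|Real.log F.A|, abs_nonneg _⟩)
    fun s hs t ht => ?_).continuousOn
  rw [Real.dist_eq, Real.dist_eq]
  rcases le_total s t with h | h
  · exact key s t hs h
  · rw [abs_sub_comm, abs_sub_comm s t]
    exact key t s ht h

/-- The mean pressure is at least `0` at `s = 0` and at most `log B < 0` at `s = 1`. -/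
theorem exists_meanPressure_eq_zero (i₀ : Fin K) (Q : Measure 𝒜) [IsProbabilityMeasure Q] :
    ∃ D : ℝ≥0, F.meanPressure Q D = 0 := by
  have hK : (1 : ℝ) ≤ K := by exact_mod_cast (Nat.one_le_iff_ne_zero.2 i₀.pos.ne')
  have h0 : 0 ≤ F.meanPressure Q 0 :=
    integral_nonneg fun u => by simpa [pressure] using Real.log_nonneg hK
  have h1 : F.meanPressure Q 1 ≤ 0 := by
    refine integral_nonpos fun u => Real.log_nonpos (F.sum_rpow_pos i₀ 1 u).le ?_
    simpa using (F.sum_le u).trans F.B_lt_one.le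
  obtain ⟨D, hD, hD0⟩ := intermediate_value_Icc' zero_le_one
    ((F.continuousOn_meanPressure i₀ Q).mono Icc_subset_Ici_self) ⟨h1, h0⟩
  exact ⟨⟨D, hD.1⟩, hD0⟩

/-- The mixture, with coefficients `θ` and `1 - θ`, of the weights proportional to the
`s`-th powers of the scaling ratios and of the point mass at `i₀`. -/
noncomputable def tiltedWeights (i₀ : Fin K) (s : ℝ) {θ : ℝ} (hθ : θ ∈ Icc (0 : ℝ) 1) (u : 𝒜) :
    Weights K :=
  ⟨fun i => θ * (F.a i u ^ s / ∑ j, F.a j u ^ s) + (1 - θ) * (if i = i₀ then 1 else 0), by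
    constructor
    · intro i
      have h1 := F.sum_rpow_pos i₀ s u
      have h2 := Real.rpow_pos_of_pos (F.a_pos i u) s
      have h3 := sub_nonneg.2 hθ.2
      have h4 := hθ.1
      have h5 : (0 : ℝ) ≤ if i = i₀ then 1 else 0 := by split_ifs <;> norm_num
      positivity
    · rw [Finset.sum_add_distrib, ← Finset.mul_sum, ← Finset.mul_sum, ← Finset.sum_div,
        div_self (F.sum_rpow_pos i₀ s u).ne']
      simp⟩

theorem tiltedWeights_apply (i₀ : Fin K) (s : ℝ) {θ : ℝ} (hθ : θ ∈ Icc (0 : ℝ) 1) (u : 𝒜)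
    (i : Fin K) : F.tiltedWeights i₀ s hθ u i =
      θ * (F.a i u ^ s / ∑ j, F.a j u ^ s) + (1 - θ) * (if i = i₀ then 1 else 0) := rfl

theorem measurable_tiltedWeights (i₀ : Fin K) (s : ℝ) {θ : ℝ} (hθ : θ ∈ Icc (0 : ℝ) 1) :
    Measurable (F.tiltedWeights i₀ s hθ) := by
  refine Measurable.subtype_mk (measurable_pi_lambda _ fun i => ?_)
  exact ((((F.measurable_a i).pow_const s).div (Finset.measurable_sum _ fun j _ =>
    (F.measurable_a j).pow_const s)).const_mul θ).add_const _

/-- `exp (z - pressure)` is the factor between `a ^ s` and `exp z` times the normalised weights. -/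
theorem rpow_mul_exp_eq (i₀ : Fin K) (s z : ℝ) (u : 𝒜) (i : Fin K) :
    F.a i u ^ s * Real.exp (-(F.pressure s u - z)) =
      Real.exp z * (F.a i u ^ s / ∑ j, F.a j u ^ s) := by
  rw [neg_sub, Real.exp_sub, pressure, Real.exp_log (F.sum_rpow_pos i₀ s u)]
  ring

theorem rpow_mul_exp_le_tiltedWeights (i₀ : Fin K) (s : ℝ) {z : ℝ}
    (hz : Real.exp z ∈ Icc (0 : ℝ) 1) (u : 𝒜) (i : Fin K) :
    F.a i u ^ s * Real.exp (-(F.pressure s u - z)) ≤ F.tiltedWeights i₀ s hz u i := by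
  rw [F.rpow_mul_exp_eq i₀, tiltedWeights_apply]
  refine le_add_of_nonneg_right (mul_nonneg (sub_nonneg.2 hz.2) ?_)
  split_ifs <;> norm_num

theorem tiltedWeights_eq_of_ne {i₀ i : Fin K} (hi : i ≠ i₀) (s : ℝ) {z : ℝ}
    (hz : Real.exp z ∈ Icc (0 : ℝ) 1) (u : 𝒜) :
    F.tiltedWeights i₀ s hz u i = F.a i u ^ s * Real.exp (-(F.pressure s u - z)) := by
  rw [F.rpow_mul_exp_eq i₀, tiltedWeights_apply]
  simp [hi]

theorem le_tiltedWeights (i₀ : Fin K) {s : ℝ} (hs : 0 ≤ s) {θ : ℝ} (hθ : θ ∈ Icc (0 : ℝ) 1)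
    (u : 𝒜) (i : Fin K) : θ * (F.A ^ s / K) ≤ F.tiltedWeights i₀ s hθ u i := by
  rw [tiltedWeights_apply]
  have hK : (0 : ℝ) < K := by exact_mod_cast i₀.pos
  refine le_add_of_le_of_nonneg (mul_le_mul_of_nonneg_left ?_ hθ.1)
    (mul_nonneg (sub_nonneg.2 hθ.2) (by split_ifs <;> norm_num))
  exact div_le_div₀ (Real.rpow_nonneg (F.a_pos i u).le s)
    (Real.rpow_le_rpow F.A_pos.le (F.A_le i u) hs) (F.sum_rpow_pos i₀ s u) (F.sum_rpow_le hs u)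

theorem ae_hasSublinearBlockSums_pressure (i₀ : Fin K) (Q : Measure 𝒜) [IsProbabilityMeasure Q]
    {s : ℝ} (hs : 0 ≤ s) {E : Type*} [MeasurableSpace E] (P : Measure E) [IsProbabilityMeasure P]
    {f : E → 𝒜} (hf : Measurable f) (hP : P.map f = Q) :
    ∀ᵐ ω ∂(Measure.infinitePi fun _ : ℕ => P),
      HasSublinearBlockSums fun n => F.pressure s (f (ω n)) - F.meanPressure Q s := by
  obtain ⟨b, hb⟩ := F.exists_abs_pressure_le i₀ hs
  refine ae_hasSublinearBlockSums P (g := fun x => F.pressure s (f x) - F.meanPressure Q s)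
    (((F.measurable_pressure s).comp hf).sub_const _) (b := b + |F.meanPressure Q s|)
    (fun x => ?_) ?_
  · have := norm_sub_le (F.pressure s (f x)) (F.meanPressure Q s)
    simp only [Real.norm_eq_abs] at this
    linarith [hb (f x)]
  have hint : Integrable (fun x => F.pressure s (f x)) P :=
    (hP ▸ F.integrable_pressure i₀ Q hs : Integrable (F.pressure s) (P.map f)).comp_measurable hf
  rw [integral_sub hint (integrable_const _), ← integral_map hf.aemeasurable
    (F.measurable_pressure s).aestronglyMeasurable, hP]
  simp [meanPressure]

theorem isAdmissibleLaw_map_tiltedWeights (i₀ : Fin K) (Q : Measure 𝒜) [IsProbabilityMeasure Q]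
    {s : ℝ} (hs : 0 ≤ s) {θ : ℝ} (hθ : θ ∈ Icc (0 : ℝ) 1) (hθ0 : 0 < θ)
    {P : ProbabilityMeasure (𝒜 × Weights K)}
    (hP : (P : Measure (𝒜 × Weights K)) = Q.map fun u => (u, F.tiltedWeights i₀ s hθ u)) :
    IsAdmissibleLaw Q P := by
  have hm : Measurable fun u => (u, F.tiltedWeights i₀ s hθ u) :=
    measurable_id.prodMk (F.measurable_tiltedWeights i₀ s hθ)
  have hK : (0 : ℝ) < K := by exact_mod_cast i₀.pos
  have hκ : 0 < θ * (F.A ^ s / K) := mul_pos hθ0 (div_pos (Real.rpow_pos_of_pos F.A_pos s) hK)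
  refine ⟨?_, 1, one_pos, fun i => ?_⟩
  · rw [hP, Measure.map_map measurable_fst hm]
    exact Measure.map_id
  · rw [hP]
    refine (lintegral_map_le _ _).trans_lt ?_
    have : ∀ u, ENNReal.ofReal (F.tiltedWeights i₀ s hθ u i) ^ (-(1 : ℝ)) ≤
        (ENNReal.ofReal (θ * (F.A ^ s / K)))⁻¹ := fun u => by
      rw [ENNReal.rpow_neg_one, ENNReal.inv_le_inv]
      exact ENNReal.ofReal_le_ofReal (F.le_tiltedWeights i₀ hs hθ u i)
    refine (lintegral_mono this).trans_lt ?_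
    rw [lintegral_const, measure_univ, mul_one, ENNReal.inv_lt_top]
    exact ENNReal.ofReal_pos.2 hκ

end IFSFamily

/-! ### The dimensions of random Moran sets and measures -/

theorem mainTheorem1 {K : ℕ} (hK : 2 ≤ K) {𝒜 : Type*} [MeasurableSpace 𝒜] (F : IFSFamily K 𝒜)
    (Q : Measure 𝒜) [IsProbabilityMeasure Q] :
    ∃ D : ℝ≥0,
      (∀ᵐ u ∂(Measure.infinitePi fun _ : ℕ => Q), dimH (F.moranSet u) = D) ∧
      ∀ d : ℝ, (D : ℝ) ≤ d →
        ∃ P : ProbabilityMeasure (𝒜 × Weights K), IsAdmissibleLaw Q P ∧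
          (∃ p : 𝒜 → Weights K, Measurable p ∧
            ∀ᵐ x ∂(P : Measure (𝒜 × Weights K)), x.2 = p x.1) ∧
          ∀ᵐ ω ∂(Measure.infinitePi fun _ : ℕ => (P : Measure (𝒜 × Weights K))),
            ∀ Φ : ℝ → ℝ, IsLargeDimensionFunction Φ →
              upperPhiDim Φ (F.moranMeasure ω) = (d : EReal) := by
  let i₀ : Fin K := ⟨0, by omega⟩
  let i₁ : Fin K := ⟨1, by omega⟩
  have hi : i₁ ≠ i₀ := by simp [i₀, i₁]
  obtain ⟨D, hD⟩ := F.exists_meanPressure_eq_zero i₀ Q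
  refine ⟨D, ?_, fun d hd => ?_⟩
  · filter_upwards [F.ae_hasSublinearBlockSums_pressure i₀ Q D.coe_nonneg Q measurable_id
      Measure.map_id] with u hu
    simp only [hD, sub_zero, id] at hu
    -- for `θ = 1` the weights are exactly proportional to `a ^ D`
    have h1 : (1 : ℝ) ∈ Icc (0 : ℝ) 1 := by simp
    refine le_antisymm (F.dimH_moranSet_le i₀ hu) ?_
    refine F.le_dimH_moranSet (ω := fun n => (u n, F.tiltedWeights i₀ D h1 (u n))) hu
      fun n i => le_of_eq ?_
    have := F.rpow_mul_exp_eq i₀ D 0 (u n) i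
    rw [sub_zero, Real.exp_zero] at this
    rw [F.tiltedWeights_apply, this]
    simp
  · have hd0 : 0 ≤ d := D.coe_nonneg.trans hd
    have hz : F.meanPressure Q d ≤ 0 := by
      rw [← hD]
      exact F.meanPressure_antitoneOn i₀ Q D.coe_nonneg hd0 hd
    have hθ : Real.exp (F.meanPressure Q d) ∈ Icc (0 : ℝ) 1 :=
      ⟨(Real.exp_pos _).le, Real.exp_le_one_iff.2 hz⟩
    set p := F.tiltedWeights i₀ d hθ with hp
    have hpm : Measurable p := F.measurable_tiltedWeights i₀ d hθ
    have hm : Measurable fun u => (u, p u) := measurable_id.prodMk hpm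
    let P : ProbabilityMeasure (𝒜 × Weights K) :=
      ⟨Q.map fun u => (u, p u), Measure.isProbabilityMeasure_map hm.aemeasurable⟩
    have hadm : IsAdmissibleLaw Q P :=
      F.isAdmissibleLaw_map_tiltedWeights i₀ Q hd0 hθ (Real.exp_pos _) rfl
    have hgraph : ∀ᵐ x ∂(P : Measure (𝒜 × Weights K)), x.2 = p x.1 :=
      (ae_map_iff hm.aemeasurable
        (measurableSet_eq_fun measurable_snd (hpm.comp measurable_fst))).2
        (ae_of_all _ fun _ => rfl)
    refine ⟨P, hadm, ⟨p, hpm, hgraph⟩, ?_⟩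
    have hall : ∀ᵐ ω ∂(Measure.infinitePi fun _ : ℕ => (P : Measure (𝒜 × Weights K))),
        ∀ n, (ω n).2 = p (ω n).1 := ae_all_iff.2 fun n =>
      (measurePreserving_eval_infinitePi (fun _ : ℕ =>
        (P : Measure (𝒜 × Weights K))) n).quasiMeasurePreserving.ae hgraph
    filter_upwards [hall, F.ae_hasSublinearBlockSums_pressure i₀ Q hd0
      (P : Measure (𝒜 × Weights K)) measurable_fst hadm.marginal] with ω hω hX Φ hΦ
    refine le_antisymm (F.upperPhiDim_moranMeasure_le hd0 hX (fun n i => ?_) hΦ)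
      (F.le_upperPhiDim_moranMeasure hX (fun _ => i₁) (fun n => ?_) hΦ.1)
    · rw [hω n]
      exact F.rpow_mul_exp_le_tiltedWeights i₀ d hθ (ω n).1 i
    · rw [hω n]
      exact F.tiltedWeights_eq_of_ne hi d hθ (ω n).1
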